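/- For real $\mu$ and complex $\nu$ let $W_{\mu,\nu}$ denote the Whittaker function on $(0,\infty)$, i.e. the solution of Whittaker's equation $$u''(x)+\Big(-\frac14+\frac{\mu}{x}+\frac{\frac14-\nu^2}{x^2}\Big)u(x)=0,\qquad x>0,$$ determined uniquely by $W_{\mu,\nu}(x)\sim x^{\mu}e^{-x/2}$ as $x\to\infty$. For real $p$ and $z>0$ let $$D_p(z)=2^{\frac p2+\frac14}\,z^{-\frac12}\,W_{\frac p2+\frac14,\frac14}\Big(\frac{z^2}{2}\Big)$$ be the parabolic cylinder function. Let $x,\alpha>0$ and $\mu<\frac12$. Then the following hold, where all series and integrals converge absolutely. (i) Summation formula: $$\Gamma^2\Big(\frac12-\mu\Big)W_{\mu,0}(x)+2\sum_{n=1}^{\infty}\Big|\Gamma\Big(\frac12-\mu+i\alpha n\Big)\Big|^2W_{\mu,i\alpha n}(x) =\frac{\pi\,2^{\mu+\frac12}\sqrt x}{\alpha}\,\Gamma(1-2\mu)\Big\{D_{2\mu-1}(\sqrt{2x})+2\sum_{n=1}^{\infty}e^{\frac{x\sinh^2(\pi n/\alpha)}{2}}D_{2\mu-1}\Big(\sqrt{2x}\cosh\Big(\frac{\pi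 n}{\alpha}\Big)\Big)\Big\}.$$ (ii) For every $\xi\in\mathbb R$, $$\int_{-\infty}^{\infty}\Big|\Gamma\Big(\frac12-\mu+i\tau\Big)\Big|^2W_{\mu,i\tau}(x)\,e^{-i\tau\xi}\,d\tau=\pi\,2^{\mu+\frac12}\sqrt x\,\Gamma(1-2\mu)\,e^{\frac{x\sinh^2(\xi/2)}{2}}D_{2\mu-1}\Big(\sqrt{2x}\cosh\Big(\frac{\xi}{2}\Big)\Big).$$ (iii) For every $\tau\in\mathbb R$, $$\Big|\Gamma\Big(\frac12-\mu+i\tau\Big)\Big|^2W_{\mu,i\tau}(x)=2^{\mu-\frac12}\sqrt x\,\Gamma(1-2\mu)\int_{-\infty}^{\infty}e^{\frac{x\sinh^2(\xi/2)}{2}}D_{2\mu-1}\Big(\sqrt{2x}\cosh\Big(\frac{\xi}{2}\Big)\Big)e^{i\tau\xi}\,d\xi.$$ -/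

import Mathlib

open Filter Asymptotics Set MeasureTheory

/-- `u` is, on the half-line `(0, ∞)`, a (twice differentiable) solution of Whittaker's differential
equation `u'' + (-1/4 + μ / x + (1/4 - ν²) / x²) u = 0`
that satisfies `u(x) ~ x ^ μ * exp (-x / 2)` as `x → ∞`.
These two requirements determine `u` uniquely on `(0, ∞)`. -/
structure IsWhittakerW (μ : ℝ) (ν : ℂ) (u : ℝ → ℂ) : Prop where
  differentiableOn : DifferentiableOn ℝ u (Ioi 0)
  differentiableOn_deriv : DifferentiableOn ℝ (deriv u) (Ioi 0)
  ode : ∀ x : ℝ, 0 < x →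
    deriv (deriv u) x
      + (-1 / 4 + (μ : ℂ) / (x : ℂ) + (1 / 4 - ν ^ 2) / (x : ℂ) ^ 2) * u x = 0
  asymptotic : u ~[atTop] fun x : ℝ => ((x ^ μ * Real.exp (-x / 2) : ℝ) : ℂ)

open Classical in
/-- The Whittaker function `W_{μ,ν}(x)`, for real `μ`, complex `ν` and `x > 0`: the solution of
Whittaker's differential equation on `(0, ∞)` with `W_{μ,ν}(x) ~ x ^ μ * exp (-x / 2)`, `x → ∞`. -/
noncomputable def whittakerW (μ : ℝ) (ν : ℂ) (x : ℝ) : ℂ :=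
  if h : ∃ u : ℝ → ℂ, IsWhittakerW μ ν u then h.choose x else 0

/-- The parabolic cylinder function
`D_p(z) = 2 ^ (p/2 + 1/4) * z ^ (-1/2) * W_{p/2 + 1/4, 1/4}(z² / 2)`, for real `p` and `z > 0`. -/
noncomputable def parabolicCylinderD (p z : ℝ) : ℂ :=
  (((2 : ℝ) ^ (p / 2 + 1 / 4) * z ^ (-(1 / 2) : ℝ) : ℝ) : ℂ)
    * whittakerW (p / 2 + 1 / 4) (1 / 4) (z ^ 2 / 2)

/-- The function `τ ↦ |Γ(1/2 - μ + iτ)|² W_{μ,iτ}(x)`. -/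
noncomputable def gammaWhittaker (μ x τ : ℝ) : ℂ :=
  ((‖Complex.Gamma (1 / 2 - (μ : ℂ) + Complex.I * (τ : ℂ))‖ ^ 2 : ℝ) : ℂ)
    * whittakerW μ (Complex.I * (τ : ℂ)) x

/-- The function `ξ ↦ exp (x sinh²(ξ/2) / 2) D_{2μ-1}(√(2x) cosh(ξ/2))`. -/
noncomputable def expCylinder (μ x ξ : ℝ) : ℂ :=
  ((Real.exp (x * Real.sinh (ξ / 2) ^ 2 / 2) : ℝ) : ℂ)
    * parabolicCylinderD (2 * μ - 1) (√(2 * x) * Real.cosh (ξ / 2))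

/-! Put `a = 1 - 2μ > 0`, `r = √(2x)`, and let `U_a(z)` be Weber's integral (`weberIntegral`), equal
to `Γ(a) exp(z²/4) D_{-a}(z)`. Since `cosh² - sinh² = 1`, the function of `ξ` on the cylinder side
is a constant times `U_a(r cosh(ξ/2))`. Everything follows from the Fourier transform of this
kernel, which is a constant times `|Γ(1/2 - μ + iτ)|² W_{μ,iτ}(x)`; this is (iii).

To compute the transform, view it as a function of `r`. The recurrence for `U_a` turns two
`ξ`-derivatives of the kernel into a differential operator in `r`
(`hasDerivAt_sinh_mul_weberIntegral`), so integrating by parts twice gives an equation in `r` with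
eigenvalue `-τ²` (`coshTransform_ode`). Multiplied by `√x exp(-x/2)`, the transform solves
Whittaker's equation. Its size at infinity comes from `U_a(z) ~ Γ(a) z^{-a}` and a beta integral
(`integral_rpow_neg_cosh_mul_exp`), which produces `|Γ(a/2 + iτ)|²`. The defining asymptotics
characterize the Whittaker function (`IsWhittakerW.eqOn`), so the transform is identified.

The kernel decays like `1/(1 + ξ²)`, and the two integrations by parts bound the transform by a
multiple of `1/(1 + τ²)`. Hence Fourier inversion applies and gives (ii), and Poisson summation
gives (i). -/

/-! ### Weber's integral: derivative, recurrence, asymptotics -/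

/-- The integral `∫₀^∞ t ^ (a - 1) * exp (-z t - t² / 2) dt`, which equals
`Γ(a) * exp (z² / 4) * D_{-a}(z)`. -/
noncomputable def weberIntegral (a z : ℝ) : ℝ :=
  ∫ t in Ioi (0 : ℝ), t ^ (a - 1) * Real.exp (-(z * t) - t ^ 2 / 2)

theorem integrableOn_rpow_sub_one_mul_exp_neg_mul {a r : ℝ} (ha : 0 < a) (hr : 0 < r) :
    IntegrableOn (fun t : ℝ => t ^ (a - 1) * Real.exp (-(r * t))) (Ioi 0) := by
  have h := integrableOn_rpow_mul_exp_neg_mul_rpow (s := a - 1) (by linarith) one_pos hr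
  simpa [neg_mul] using h

theorem weberIntegral_integrand_le (a z : ℝ) {t : ℝ} (ht : 0 < t) :
    t ^ (a - 1) * Real.exp (-(z * t) - t ^ 2 / 2) ≤ t ^ (a - 1) * Real.exp (-(z * t)) := by
  gcongr
  nlinarith [sq_nonneg t]

theorem measurable_weberIntegral_integrand (a z : ℝ) :
    Measurable fun t : ℝ => t ^ (a - 1) * Real.exp (-(z * t) - t ^ 2 / 2) := by
  fun_prop

theorem integrableOn_weberIntegral {a z : ℝ} (ha : 0 < a) (hz : 0 < z) :
    IntegrableOn (fun t : ℝ => t ^ (a - 1) * Real.exp (-(z * t) - t ^ 2 / 2)) (Ioi 0) := by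
  refine Integrable.mono' (integrableOn_rpow_sub_one_mul_exp_neg_mul ha hz)
    (measurable_weberIntegral_integrand a z).aestronglyMeasurable ?_
  refine (ae_restrict_iff' measurableSet_Ioi).2 (Eventually.of_forall fun t (ht : 0 < t) => ?_)
  rw [Real.norm_of_nonneg (by positivity)]
  exact weberIntegral_integrand_le a z ht

theorem weberIntegral_nonneg (a z : ℝ) : 0 ≤ weberIntegral a z :=
  setIntegral_nonneg measurableSet_Ioi fun t (ht : 0 < t) => by positivity

/-- Dropping `exp(-t²/2)` leaves Euler's integral. All later majorants in `ξ` come from this bound.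
-/
theorem weberIntegral_le {a z : ℝ} (ha : 0 < a) (hz : 0 < z) :
    weberIntegral a z ≤ Real.Gamma a * z ^ (-a) := by
  have h := Real.integral_rpow_mul_exp_neg_mul_Ioi ha hz
  rw [one_div, Real.inv_rpow hz.le, ← Real.rpow_neg hz.le, mul_comm] at h
  rw [← h]
  exact setIntegral_mono_on (integrableOn_weberIntegral ha hz)
    (integrableOn_rpow_sub_one_mul_exp_neg_mul ha hz) measurableSet_Ioi
    fun t ht => weberIntegral_integrand_le a z ht

theorem hasDerivAt_weberIntegral {a z : ℝ} (ha : 0 < a) (hz : 0 < z) :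
    HasDerivAt (weberIntegral a) (-weberIntegral (a + 1) z) z := by
  have key := hasDerivAt_integral_of_dominated_loc_of_deriv_le
    (μ := volume.restrict (Ioi (0 : ℝ))) (x₀ := z) (s := Ioi (z / 2))
    (F := fun y t : ℝ => t ^ (a - 1) * Real.exp (-(y * t) - t ^ 2 / 2))
    (F' := fun y t : ℝ => -(t ^ ((a + 1) - 1) * Real.exp (-(y * t) - t ^ 2 / 2)))
    (bound := fun t => t ^ ((a + 1) - 1) * Real.exp (-(z / 2 * t)))
    (Ioi_mem_nhds (by linarith))
    (Eventually.of_forall fun y => (measurable_weberIntegral_integrand a y).aestronglyMeasurable)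
    (integrableOn_weberIntegral ha hz)
    (measurable_weberIntegral_integrand (a + 1) z).neg.aestronglyMeasurable
    ?_ (integrableOn_rpow_sub_one_mul_exp_neg_mul (by linarith) (by linarith)) ?_
  · have h := key.2
    rw [integral_neg] at h
    exact h
  · refine (ae_restrict_iff' measurableSet_Ioi).2
      (Eventually.of_forall fun t (ht : 0 < t) y (hy : z / 2 < y) => ?_)
    rw [norm_neg, Real.norm_of_nonneg (by positivity)]
    gcongr
    nlinarith [mul_lt_mul_of_pos_right hy ht, sq_nonneg t]
  · refine (ae_restrict_iff' measurableSet_Ioi).2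
      (Eventually.of_forall fun t (ht : 0 < t) y (hy : z / 2 < y) => ?_)
    have h1 : HasDerivAt (fun y : ℝ => -(y * t) - t ^ 2 / 2) (-t) y := by
      simpa using (((hasDerivAt_id y).mul_const t).neg).sub_const (t ^ 2 / 2)
    have h2 := (h1.exp).const_mul (t ^ (a - 1))
    refine h2.congr_deriv ?_
    rw [show a + 1 - 1 = (a - 1) + 1 by ring, Real.rpow_add_one ht.ne']
    ring

theorem continuousOn_weberIntegral {a : ℝ} (ha : 0 < a) :
    ContinuousOn (weberIntegral a) (Ioi 0) := fun _ hz =>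
  (hasDerivAt_weberIntegral ha hz).continuousAt.continuousWithinAt

/-- The recurrence obtained by integrating the derivative of `t ^ a * exp (-z t - t² / 2)`. -/
theorem weberIntegral_add_two {a z : ℝ} (ha : 0 < a) (hz : 0 < z) :
    weberIntegral (a + 2) z = a * weberIntegral a z - z * weberIntegral (a + 1) z := by
  have i0 := integrableOn_weberIntegral ha hz
  have i1 := integrableOn_weberIntegral (a := a + 1) (by linarith) hz
  have i2 := integrableOn_weberIntegral (a := a + 2) (by linarith) hz
  have key := integral_Ioi_of_hasDerivAt_of_tendsto (a := (0 : ℝ)) (m := 0)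
    (f := fun t : ℝ => t ^ a * Real.exp (-(z * t) - t ^ 2 / 2))
    (f' := fun t : ℝ => a * (t ^ (a - 1) * Real.exp (-(z * t) - t ^ 2 / 2))
      - z * (t ^ (a + 1 - 1) * Real.exp (-(z * t) - t ^ 2 / 2))
      - t ^ (a + 2 - 1) * Real.exp (-(z * t) - t ^ 2 / 2)) ?_ ?_ ?_ ?_
  · have i01 : IntegrableOn (fun t : ℝ => a * (t ^ (a - 1) * Real.exp (-(z * t) - t ^ 2 / 2))
        - z * (t ^ (a + 1 - 1) * Real.exp (-(z * t) - t ^ 2 / 2))) (Ioi 0) :=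
      (i0.const_mul a).sub (i1.const_mul z)
    rw [integral_sub i01 i2, integral_sub (i0.const_mul a) (i1.const_mul z), integral_const_mul, integral_const_mul] at key
    simp only [Real.zero_rpow ha.ne', zero_mul, sub_zero] at key
    unfold weberIntegral
    linarith
  · refine ContinuousAt.continuousWithinAt ?_
    have : ContinuousAt (fun t : ℝ => t ^ a) 0 := Real.continuousAt_rpow_const _ _ (Or.inr ha.le)
    exact this.mul (by fun_prop)
  · intro t (ht : 0 < t)
    have h1 : HasDerivAt (fun t : ℝ => -(z * t) - t ^ 2 / 2) (-z - t) t := by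
      have := (((hasDerivAt_id t).const_mul z).neg).sub (((hasDerivAt_id t).pow 2).div_const 2)
      refine this.congr_deriv ?_
      norm_num
    have h2 := (Real.hasDerivAt_rpow_const (p := a) (Or.inl ht.ne')).mul h1.exp
    refine h2.congr_deriv ?_
    rw [show a + 1 - 1 = (a - 1) + 1 by ring, show a + 2 - 1 = (a - 1) + 1 + 1 by ring,
      Real.rpow_add_one ht.ne', Real.rpow_add_one ht.ne', Real.rpow_add_one ht.ne',
      show t ^ a = t ^ (a - 1) * t by rw [← Real.rpow_add_one ht.ne']; congr 1; ring]
    ring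
  · exact ((i0.const_mul a).sub (i1.const_mul z)).sub i2
  · have h := tendsto_rpow_mul_exp_neg_mul_atTop_nhds_zero a z hz
    refine squeeze_zero' (g := fun t : ℝ => t ^ a * Real.exp (-z * t)) ?_ ?_ h
    · filter_upwards [eventually_gt_atTop 0] with t ht
      positivity
    · filter_upwards [eventually_gt_atTop 0] with t ht
      gcongr
      nlinarith [sq_nonneg t]

/-- Rescaling `t` by `z` moves all dependence on `z` into a Gaussian factor that tends to 1 as `z →
∞`. -/
theorem rpow_mul_weberIntegral {a z : ℝ} (hz : 0 < z) :
    z ^ a * weberIntegral a z =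
      ∫ t in Ioi (0 : ℝ), t ^ (a - 1) * Real.exp (-t - (t / z) ^ 2 / 2) := by
  have h := integral_comp_mul_left_Ioi
    (fun t : ℝ => t ^ (a - 1) * Real.exp (-t - (t / z) ^ 2 / 2)) 0 hz
  rw [mul_zero, smul_eq_mul] at h
  have h2 : ∫ t in Ioi (0 : ℝ), t ^ (a - 1) * Real.exp (-t - (t / z) ^ 2 / 2) =
      z * ∫ t in Ioi (0 : ℝ), (z * t) ^ (a - 1) * Real.exp (-(z * t) - (z * t / z) ^ 2 / 2) := by
    rw [h]
    field_simp
  rw [h2, weberIntegral, ← integral_const_mul, ← integral_const_mul]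
  refine setIntegral_congr_fun measurableSet_Ioi fun t (ht : 0 < t) => ?_
  have e1 : z * t / z = t := by field_simp
  have e2 : z ^ a = z * z ^ (a - 1) := by
    rw [mul_comm, ← Real.rpow_add_one hz.ne']; congr 1; ring
  simp only [e1, Real.mul_rpow hz.le ht.le, e2]
  ring

theorem tendsto_rpow_mul_weberIntegral {a : ℝ} (ha : 0 < a) :
    Tendsto (fun z => z ^ a * weberIntegral a z) atTop (nhds (Real.Gamma a)) := by
  have key : Tendsto (fun z : ℝ =>
      ∫ t in Ioi (0 : ℝ), t ^ (a - 1) * Real.exp (-t - (t / z) ^ 2 / 2)) atTop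
      (nhds (∫ t in Ioi (0 : ℝ), t ^ (a - 1) * Real.exp (-(1 * t)))) := by
    refine tendsto_integral_filter_of_dominated_convergence
      (fun t => t ^ (a - 1) * Real.exp (-(1 * t))) ?_ ?_
      (integrableOn_rpow_sub_one_mul_exp_neg_mul ha one_pos) ?_
    · exact Eventually.of_forall fun z => Measurable.aestronglyMeasurable (by fun_prop)
    · refine Eventually.of_forall fun z => (ae_restrict_iff' measurableSet_Ioi).2
        (Eventually.of_forall fun t (ht : 0 < t) => ?_)
      rw [Real.norm_of_nonneg (by positivity)]
      gcongr
      nlinarith [sq_nonneg (t / z)]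
    · refine Eventually.of_forall fun t => ?_
      have h0 : Tendsto (fun z : ℝ => t / z) atTop (nhds 0) := tendsto_const_nhds.div_atTop tendsto_id
      have h1 : Tendsto (fun z : ℝ => -t - (t / z) ^ 2 / 2) atTop (nhds (-t - 0 ^ 2 / 2)) :=
        tendsto_const_nhds.sub ((h0.pow 2).div_const 2)
      have h2 := (Real.continuous_exp.tendsto _).comp h1
      simpa using h2.const_mul (t ^ (a - 1))
  rw [Real.integral_rpow_mul_exp_neg_mul_Ioi ha one_pos] at key
  simp only [div_one, Real.one_rpow, one_mul] at key
  refine key.congr' ?_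
  filter_upwards [eventually_gt_atTop 0] with z hz
  rw [rpow_mul_weberIntegral hz]

/-! ### Uniqueness of the Whittaker function -/

/-- Uniqueness for the first-order system `(w, w')`, run backwards from `b`; in the sup norm it is
Lipschitz with constant `max 1 (sup ‖c‖)`. -/
theorem eqOn_zero_of_deriv_deriv_eq_mul {c w w' : ℝ → ℂ} {a b : ℝ} (hab : a ≤ b)
    (hc : ContinuousOn c (Icc a b)) (hw : ∀ x ∈ Icc a b, HasDerivAt w (w' x) x)
    (hw' : ∀ x ∈ Icc a b, HasDerivAt w' (c x * w x) x) (h0 : w b = 0) (h1 : w' b = 0) :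
    w a = 0 := by
  obtain ⟨K, hK⟩ := isCompact_Icc.exists_bound_of_continuousOn hc
  have hd : ∀ x ∈ Icc a b, HasDerivAt (fun x => (w x, w' x)) (w' x, c x * w x) x :=
    fun x hx => (hw x hx).prodMk (hw' x hx)
  have key := ODE_solution_unique_of_mem_Icc_left (a := a) (b := b) (K := max 1 K.toNNReal)
    (v := fun t (p : ℂ × ℂ) => (p.2, c t * p.1)) (s := fun _ => univ)
    (f := fun x => (w x, w' x)) (g := fun _ => (0, 0)) ?_
    (fun x hx => (hd x hx).continuousAt.continuousWithinAt)
    (fun x hx => (hd x (Ioc_subset_Icc_self hx)).hasDerivWithinAt) (fun _ _ => mem_univ _)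
    continuousOn_const
    (fun x _ => (hasDerivWithinAt_const x (Iic x) ((0 : ℂ), (0 : ℂ))).congr_deriv (by simp; rfl))
    (fun _ _ => mem_univ _) (by simp [h0, h1])
  · exact congrArg Prod.fst (key (left_mem_Icc.2 hab))
  · intro t ht
    refine LipschitzOnWith.of_dist_le_mul fun p _ q _ => ?_
    have hKt := (hK t (Ioc_subset_Icc_self ht)).trans (Real.le_coe_toNNReal K)
    rw [Prod.dist_eq, Prod.dist_eq]
    have hm1 : (1 : ℝ) ≤ (max 1 K.toNNReal : NNReal) := by
      exact_mod_cast le_max_left 1 K.toNNReal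
    have hmK : ‖c t‖ ≤ (max 1 K.toNNReal : NNReal) :=
      hKt.trans (by exact_mod_cast le_max_right 1 K.toNNReal)
    refine max_le ?_ ?_
    · calc dist p.2 q.2 ≤ max (dist p.1 q.1) (dist p.2 q.2) := le_max_right _ _
        _ ≤ _ := le_mul_of_one_le_left (le_max_of_le_left dist_nonneg) hm1
    · simp only [dist_eq_norm]
      rw [← mul_sub, norm_mul]
      exact mul_le_mul hmK (le_max_left _ _) (norm_nonneg _) (by positivity)

/-- Two solutions of Whittaker's equation with the same behaviour `x ^ μ * exp (-x / 2)` at infinity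
agree on the half-line. -/
theorem IsWhittakerW.eqOn {μ : ℝ} {ν : ℂ} {u v : ℝ → ℂ} (hu : IsWhittakerW μ ν u)
    (hv : IsWhittakerW μ ν v) : EqOn u v (Ioi 0) := by
  set c : ℝ → ℂ := fun x =>
    -(-1 / 4 + (μ : ℂ) / (x : ℂ) + (1 / 4 - ν ^ 2) / (x : ℂ) ^ 2) with hc
  have hd : ∀ {f : ℝ → ℂ}, DifferentiableOn ℝ f (Ioi 0) → ∀ x : ℝ, 0 < x →
      HasDerivAt f (deriv f x) x := fun hf x hx =>
    (hf.differentiableAt (Ioi_mem_nhds hx)).hasDerivAt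
  have hode : ∀ {f : ℝ → ℂ}, IsWhittakerW μ ν f → ∀ x : ℝ, 0 < x →
      HasDerivAt (deriv f) (c x * f x) x := by
    intro f hf x hx
    refine (hd hf.differentiableOn_deriv x hx).congr_deriv ?_
    linear_combination hf.ode x hx
  have hu1 := hd hu.differentiableOn
  have hv1 := hd hv.differentiableOn
  have hu2 := hode hu
  have hv2 := hode hv
  have hcc : ContinuousOn c (Ioi 0) := by
    intro x (hx : 0 < x)
    have hx' : (x : ℂ) ≠ 0 := by exact_mod_cast hx.ne'
    refine ContinuousAt.continuousWithinAt ?_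
    have h1 : ContinuousAt (fun x : ℝ => (x : ℂ)) x := Complex.continuous_ofReal.continuousAt
    exact ((continuousAt_const.add (continuousAt_const.div h1 hx')).add
      (continuousAt_const.div (h1.pow 2) (pow_ne_zero 2 hx'))).neg
  -- the difference and its Wronskian with `v`
  set w : ℝ → ℂ := fun x => u x - v x with hw
  set w' : ℝ → ℂ := fun x => deriv u x - deriv v x with hw'
  have hw1 : ∀ x : ℝ, 0 < x → HasDerivAt w (w' x) x := fun x hx => (hu1 x hx).sub (hv1 x hx)
  have hw2 : ∀ x : ℝ, 0 < x → HasDerivAt w' (c x * w x) x := fun x hx =>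
    ((hu2 x hx).sub (hv2 x hx)).congr_deriv (by simp only [hw]; ring)
  -- The equation has no first-order term, so the Wronskian is constant.
  obtain ⟨C, hC⟩ : ∃ C : ℂ, ∀ x : ℝ, 0 < x → w' x * v x - w x * deriv v x = C := by
    have hW : ∀ x : ℝ, 0 < x →
        HasDerivAt (fun x => w' x * v x - w x * deriv v x) 0 x := fun x hx =>
      (((hw2 x hx).mul (hv1 x hx)).sub ((hw1 x hx).mul (hv2 x hx))).congr_deriv (by ring)
    refine ⟨w' 1 * v 1 - w 1 * deriv v 1, fun x hx => ?_⟩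
    exact isOpen_Ioi.is_const_of_deriv_eq_zero isPreconnected_Ioi
      (fun y hy => (hW y hy).differentiableAt.differentiableWithinAt)
      (fun y hy => (hW y hy).deriv) hx (mem_Ioi.2 one_pos)
  set A : ℝ → ℝ := fun x => x ^ μ * Real.exp (-x / 2) with hA
  have hApos : ∀ x : ℝ, 0 < x → 0 < A x := fun x hx => by positivity
  have hA0 : ∀ᶠ x : ℝ in atTop, ((A x : ℝ) : ℂ) ≠ 0 := by
    filter_upwards [eventually_gt_atTop 0] with x hx
    exact_mod_cast (hApos x hx).ne'
  have hAlim : Tendsto A atTop (nhds 0) := by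
    have := tendsto_rpow_mul_exp_neg_mul_atTop_nhds_zero μ (1 / 2) (by norm_num)
    refine this.congr fun x => ?_
    simp only [hA]
    congr 2
    ring
  have hvA : Tendsto (fun x => v x / (A x : ℂ)) atTop (nhds 1) :=
    (isEquivalent_iff_tendsto_one hA0).1 hv.asymptotic
  have huA : Tendsto (fun x => u x / (A x : ℂ)) atTop (nhds 1) :=
    (isEquivalent_iff_tendsto_one hA0).1 hu.asymptotic
  have hAv : Tendsto (fun x => (A x : ℂ) / v x) atTop (nhds 1) := by
    have := hvA.inv₀ one_ne_zero
    simpa using this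
  have hv0 : ∀ᶠ x in atTop, v x ≠ 0 := by
    filter_upwards [hvA.eventually_ne one_ne_zero] with x hx h
    simp [h] at hx
  -- The asymptotics force `q = u/v - 1 → 0`, while `q' = C / v²` is large because `v` decays. This
  -- forces `C = 0` without any information on `u'` and `v'` at infinity.
  set q : ℝ → ℂ := fun x => w x / v x with hq
  have hq0 : Tendsto q atTop (nhds 0) := by
    have : Tendsto (fun x => u x / (A x : ℂ) * ((A x : ℂ) / v x) - 1) atTop (nhds (1 * 1 - 1)) :=
      (huA.mul hAv).sub_const 1
    rw [mul_one, sub_self] at this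
    refine this.congr' ?_
    filter_upwards [hA0, hv0] with x h1 h2
    simp only [hq, hw]
    field_simp
  have hq1 : ∀ x : ℝ, 0 < x → v x ≠ 0 → HasDerivAt q (C / v x ^ 2) x := fun x hx h =>
    ((hw1 x hx).div (hv1 x hx) h).congr_deriv (by rw [hC x hx])
  have hgrow : ∀ᶠ x in atTop, 1 ≤ (1 / v x ^ 2).re := by
    have h1 : Tendsto (fun x => (((A x : ℂ) / v x) ^ 2).re) atTop (nhds 1) := by
      have := (Complex.continuous_re.tendsto _).comp (hAv.pow 2)
      simpa [Function.comp_def] using this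
    have h2 : ∀ᶠ x in atTop, A x < 1 / 2 := hAlim.eventually_lt_const (by norm_num)
    filter_upwards [h1.eventually_const_lt (show (1 / 2 : ℝ) < 1 by norm_num), h2, hA0, hv0,
      eventually_gt_atTop 0] with x h1 h2 h3 h4 hx
    have hpos := hApos x hx
    have e : ((A x : ℂ) / v x) ^ 2 = ((A x ^ 2 : ℝ) : ℂ) * (1 / v x ^ 2) := by
      push_cast
      field_simp
    rw [e, Complex.re_ofReal_mul] at h1
    by_contra! hlt
    have hA2 : A x ^ 2 < 1 / 2 := by nlinarith
    nlinarith [mul_lt_mul_of_pos_left hlt (pow_pos hpos 2)]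
  obtain ⟨X, hX⟩ := eventually_atTop.1 ((hgrow.and hv0).and (eventually_gt_atTop (0 : ℝ)))
  have hC0 : C = 0 := by
    by_contra hne
    -- Eventually `g' = Re(1/v²) ≥ 1`, so `g` would tend to infinity, although `q → 0`.
    set g : ℝ → ℝ := fun x => (q x / C).re with hg
    have hg1 : ∀ x, X ≤ x → HasDerivAt g ((1 / v x ^ 2).re) x := by
      intro x hx
      have h := (hq1 x (hX x hx).2 (hX x hx).1.2).div_const C
      have h' := Complex.reCLM.hasFDerivAt.comp_hasDerivAt x h
      refine h'.congr_deriv ?_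
      simp only [Complex.reCLM_apply]
      congr 1
      field_simp
    have hg0 : Tendsto g atTop (nhds 0) := by
      have := (Complex.continuous_re.tendsto _).comp (hq0.div_const C)
      simpa [Function.comp_def] using this
    have hmono : MonotoneOn (fun x => g x - x) (Ici X) := by
      refine monotoneOn_of_deriv_nonneg (convex_Ici X)
        (fun x hx => ((hg1 x hx).continuousAt.sub continuousAt_id).continuousWithinAt) ?_ ?_
      · intro x hx
        rw [interior_Ici] at hx
        exact ((hg1 x hx.out.le).sub (hasDerivAt_id x)).differentiableAt.differentiableWithinAt
      · intro x hx
        rw [interior_Ici] at hx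
        have := (hg1 x hx.out.le).sub (hasDerivAt_id x)
        rw [show deriv (fun x => g x - x) x = _ from this.deriv]
        linarith [(hX x hx.out.le).1.1]
    have hlim : Tendsto g atTop atTop := by
      refine tendsto_atTop_mono' atTop ?_ (tendsto_atTop_add_const_right atTop (g X - X) tendsto_id)
      filter_upwards [eventually_ge_atTop X] with x hx
      have := hmono (mem_Ici.2 le_rfl) (mem_Ici.2 hx) hx
      simp only at this
      simp only [id]
      linarith
    exact not_tendsto_nhds_of_tendsto_atTop hlim 0 hg0
  have hqz : ∀ x, X < x → q x = 0 := by
    intro x hx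
    have hconst : ∀ y ∈ Ioi X, q y = q x := fun y hy =>
      isOpen_Ioi.is_const_of_deriv_eq_zero isPreconnected_Ioi
        (fun y (hy : X < y) =>
          (hq1 y (hX y hy.le).2 (hX y hy.le).1.2).differentiableAt.differentiableWithinAt)
        (fun y (hy : X < y) => by
          rw [(hq1 y (hX y hy.le).2 (hX y hy.le).1.2).deriv, hC0, zero_div]; rfl) hy hx
    have : Tendsto q atTop (nhds (q x)) := by
      refine tendsto_const_nhds.congr' ?_
      filter_upwards [eventually_gt_atTop X] with y hy
      exact (hconst y hy).symm
    exact tendsto_nhds_unique this hq0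
  have hwz : ∀ x, X < x → w x = 0 := fun x hx =>
    (div_eq_zero_iff.1 (hqz x hx)).resolve_right (hX x hx.le).1.2
  intro x (hx : 0 < x)
  -- The difference vanishes near infinity; this point lies beyond both `X` and `x`, and the
  -- backward uniqueness carries the zero down to `x`.
  have hb : X < max X x + 1 := by linarith [le_max_left X x]
  have hwb' : w' (max X x + 1) = 0 := by
    have h1 := hw1 _ ((hX _ hb.le).2)
    have h2 : w =ᶠ[nhds (max X x + 1)] fun _ => 0 := by
      filter_upwards [Ioi_mem_nhds hb] with y hy
      exact hwz y hy
    rw [← h1.deriv, h2.deriv_eq, deriv_const]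
  have := eqOn_zero_of_deriv_deriv_eq_mul (a := x) (b := max X x + 1)
    (by linarith [le_max_right X x]) (hcc.mono fun y hy => hx.trans_le hy.1)
    (fun y hy => hw1 y (hx.trans_le hy.1)) (fun y hy => hw2 y (hx.trans_le hy.1)) (hwz _ hb) hwb'
  exact sub_eq_zero.1 this

/-- By uniqueness the choice in the definition is harmless: any exhibited solution computes
`whittakerW`. -/
theorem whittakerW_eq {μ : ℝ} {ν : ℂ} {u : ℝ → ℂ} (hu : IsWhittakerW μ ν u) {x : ℝ} (hx : 0 < x) :
    whittakerW μ ν x = u x := by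
  have h : ∃ u : ℝ → ℂ, IsWhittakerW μ ν u := ⟨u, hu⟩
  rw [whittakerW, dif_pos h]
  exact h.choose_spec.eqOn hu hx

/-! ### Powers of cosh and their Fourier transform -/

/-- Uses `cosh(ξ/2) ≥ exp(|ξ|/2)/2` and `exp y ≥ 1 + y²/2` for `y ≥ 0`. The true decay is
exponential, but quadratic decay suffices for integrability and for Poisson summation. -/
theorem rpow_neg_cosh_le {a : ℝ} (ha : 0 < a) (ξ : ℝ) :
    Real.cosh (ξ / 2) ^ (-a) ≤ 2 ^ a * (1 + 8 / a ^ 2) * (1 + ξ ^ 2)⁻¹ := by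
  have hc : Real.exp (|ξ| / 2) / 2 ≤ Real.cosh (ξ / 2) := by
    rw [← Real.cosh_abs, abs_div, abs_two, Real.cosh_eq]
    linarith [Real.exp_pos (-(|ξ| / 2))]
  have hq : 1 + a ^ 2 * ξ ^ 2 / 8 ≤ Real.exp (|ξ| / 2 * a) := by
    have h := Real.quadratic_le_exp_of_nonneg (x := |ξ| / 2 * a) (by positivity)
    have e : (|ξ| / 2 * a) ^ 2 = a ^ 2 * ξ ^ 2 / 4 := by rw [mul_pow, div_pow, sq_abs]; ring
    rw [e] at h
    have : 0 ≤ |ξ| / 2 * a := by positivity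
    linarith
  have h1 : (2 ^ a)⁻¹ * Real.exp (|ξ| / 2 * a) ≤ Real.cosh (ξ / 2) ^ a := by
    have := Real.rpow_le_rpow (by positivity) hc ha.le
    rwa [Real.div_rpow (Real.exp_pos _).le (by norm_num), ← Real.exp_mul, div_eq_inv_mul] at this
  have hpos : 0 < Real.cosh (ξ / 2) ^ a := Real.rpow_pos_of_pos (Real.cosh_pos _) _
  rw [Real.rpow_neg (Real.cosh_pos _).le, ← div_eq_mul_inv, inv_eq_one_div,
    div_le_div_iff₀ hpos (by positivity), one_mul]
  have h2 : Real.exp (|ξ| / 2 * a) ≤ 2 ^ a * Real.cosh (ξ / 2) ^ a := by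
    rwa [inv_mul_le_iff₀ (by positivity)] at h1
  have h3 : 1 + ξ ^ 2 ≤ (1 + 8 / a ^ 2) * (1 + a ^ 2 * ξ ^ 2 / 8) := by
    have : (1 + 8 / a ^ 2) * (1 + a ^ 2 * ξ ^ 2 / 8)
        = 1 + ξ ^ 2 + (8 / a ^ 2 + a ^ 2 * ξ ^ 2 / 8) := by
      field_simp
      ring
    rw [this]
    have : 0 ≤ 8 / a ^ 2 + a ^ 2 * ξ ^ 2 / 8 := by positivity
    linarith
  calc 1 + ξ ^ 2 ≤ (1 + 8 / a ^ 2) * (1 + a ^ 2 * ξ ^ 2 / 8) := h3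
    _ ≤ (1 + 8 / a ^ 2) * (2 ^ a * Real.cosh (ξ / 2) ^ a) := by
        gcongr
        exact hq.trans h2
    _ = _ := by ring

theorem continuous_rpow_cosh (b : ℝ) : Continuous fun ξ : ℝ => Real.cosh (ξ / 2) ^ b :=
  Continuous.rpow_const (by fun_prop) fun _ => Or.inl (Real.cosh_pos _).ne'

theorem integrable_rpow_neg_cosh {a : ℝ} (ha : 0 < a) :
    Integrable fun ξ : ℝ => Real.cosh (ξ / 2) ^ (-a) := by
  refine Integrable.mono' (integrable_inv_one_add_sq.const_mul (2 ^ a * (1 + 8 / a ^ 2)))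
    (continuous_rpow_cosh _).aestronglyMeasurable (Eventually.of_forall fun ξ => ?_)
  rw [Real.norm_of_nonneg (Real.rpow_nonneg (Real.cosh_pos _).le _)]
  exact rpow_neg_cosh_le ha ξ

theorem sigmoid_mul_one_sub (ξ : ℝ) :
    Real.sigmoid ξ * (1 - Real.sigmoid ξ) = (4 * Real.cosh (ξ / 2) ^ 2)⁻¹ := by
  have h : (2 * Real.cosh (ξ / 2)) ^ 2 = 2 + Real.exp ξ + Real.exp (-ξ) := by
    rw [Real.cosh_eq]
    have e1 : Real.exp ξ = Real.exp (ξ / 2) ^ 2 := by rw [← Real.exp_nat_mul]; congr 1; ring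
    have e2 : Real.exp (-ξ) = Real.exp (-(ξ / 2)) ^ 2 := by
      rw [← Real.exp_nat_mul]; congr 1; ring
    have e3 : Real.exp (ξ / 2) * Real.exp (-(ξ / 2)) = 1 := by rw [← Real.exp_add]; simp
    rw [e1, e2]
    linear_combination 2 * e3
  rw [← Real.sigmoid_neg, Real.sigmoid_def, Real.sigmoid_def, neg_neg, ← mul_inv]
  congr 1
  have e : Real.exp (-ξ) * Real.exp ξ = 1 := by rw [← Real.exp_add]; simp
  linear_combination e - h

/-- With `s = a/2 + iτ`, substitute `t = sigmoid ξ` in the beta integral `B(s, s̄) = |Γ(s)|²/Γ(a)`.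
Then `dt = t(1 - t) dξ`, `t/(1 - t) = exp ξ` and `t(1 - t) = (2 cosh(ξ/2))⁻²`, so `t^s (1 - t)^s̄ =
(2 cosh(ξ/2))^(-a) exp(iτξ)`. -/
theorem integral_rpow_neg_cosh_mul_exp {a : ℝ} (ha : 0 < a) (τ : ℝ) :
    ((Real.Gamma a : ℝ) : ℂ) *
        ∫ ξ : ℝ, ((Real.cosh (ξ / 2) ^ (-a) : ℝ) : ℂ) * Complex.exp (Complex.I * τ * ξ) =
      ((2 ^ a * ‖Complex.Gamma ((a / 2 : ℝ) + Complex.I * τ)‖ ^ 2 : ℝ) : ℂ) := by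
  set s : ℂ := (a / 2 : ℝ) + Complex.I * τ with hs
  have hsre : s.re = a / 2 := by simp [hs]
  have hconj : (starRingEnd ℂ) s = (a / 2 : ℝ) - Complex.I * τ := by
    rw [hs, map_add, map_mul, Complex.conj_ofReal, Complex.conj_I, Complex.conj_ofReal]; ring
  have hbeta := Complex.Gamma_mul_Gamma_eq_betaIntegral (s := s) (t := (starRingEnd ℂ) s)
    (by rw [hsre]; positivity) (by rw [Complex.conj_re, hsre]; positivity)
  have hsum : s + (starRingEnd ℂ) s = (a : ℂ) := by
    rw [hconj, hs]; push_cast; ring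
  rw [hsum, Complex.Gamma_ofReal, Complex.Gamma_conj, Complex.mul_conj,
    Complex.normSq_eq_norm_sq] at hbeta
  have hint : s.betaIntegral ((starRingEnd ℂ) s) = (((2 : ℝ) ^ (-a) : ℝ) : ℂ) *
      ∫ ξ : ℝ, ((Real.cosh (ξ / 2) ^ (-a) : ℝ) : ℂ) * Complex.exp (Complex.I * τ * ξ) := by
    rw [Complex.betaIntegral, intervalIntegral.integral_of_le zero_le_one,
      ← integral_Ioc_eq_integral_Ioo.symm, ← Real.range_sigmoid, ← image_univ,
      integral_image_eq_integral_abs_deriv_smul MeasurableSet.univ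
        (fun ξ _ => (Real.hasDerivAt_sigmoid ξ).hasDerivWithinAt) Real.sigmoid_injective.injOn,
      setIntegral_univ, ← integral_const_mul]
    congr 1
    ext ξ
    have p1 := Real.sigmoid_pos ξ
    have p2 := Real.sigmoid_lt_one ξ
    have p3 : 0 < 1 - Real.sigmoid ξ := by linarith
    have pc := Real.cosh_pos (ξ / 2)
    have hlog : Real.log (Real.sigmoid ξ) - Real.log (1 - Real.sigmoid ξ) = ξ := by
      rw [← Real.sigmoid_neg, ← Real.sigmoid_mul_rexp_neg, Real.log_mul p1.ne' (Real.exp_pos _).ne',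
        Real.log_exp]
      ring
    have hlog2 : Real.log (Real.sigmoid ξ) + Real.log (1 - Real.sigmoid ξ) =
        -(2 * Real.log 2 + 2 * Real.log (Real.cosh (ξ / 2))) := by
      rw [← Real.log_mul p1.ne' p3.ne', sigmoid_mul_one_sub, Real.log_inv,
        Real.log_mul (by norm_num) (by positivity), Real.log_pow,
        show (4 : ℝ) = 2 ^ 2 by norm_num, Real.log_pow]
      norm_num
    have q1 : ((Real.sigmoid ξ : ℝ) : ℂ) ≠ 0 := by exact_mod_cast p1.ne'
    have q3 : (1 - (Real.sigmoid ξ : ℂ)) ≠ 0 := by exact_mod_cast p3.ne'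
    rw [abs_of_pos (mul_pos p1 p3), Complex.real_smul, Complex.cpow_sub _ _ q1,
      Complex.cpow_sub _ _ q3, Complex.cpow_one, Complex.cpow_one]
    have e1 : ((Real.sigmoid ξ : ℝ) : ℂ) ^ s * (1 - (Real.sigmoid ξ : ℂ)) ^ ((starRingEnd ℂ) s) =
        (((2 : ℝ) ^ (-a) : ℝ) : ℂ) * (((Real.cosh (ξ / 2) ^ (-a) : ℝ) : ℂ)
          * Complex.exp (Complex.I * τ * ξ)) := by
      rw [Complex.cpow_def_of_ne_zero q1, Complex.cpow_def_of_ne_zero q3,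
        show (1 - (Real.sigmoid ξ : ℂ)) = ((1 - Real.sigmoid ξ : ℝ) : ℂ) by push_cast; rfl,
        ← Complex.ofReal_log p1.le, ← Complex.ofReal_log p3.le,
        Real.rpow_def_of_pos two_pos, Real.rpow_def_of_pos pc, Complex.ofReal_exp,
        Complex.ofReal_exp, ← Complex.exp_add, ← Complex.exp_add, ← Complex.exp_add, hconj, hs]
      congr 1
      have l1 : (Real.log (Real.sigmoid ξ) : ℂ) - Real.log (1 - Real.sigmoid ξ) = ξ := by
        exact_mod_cast hlog
      have l2 : (Real.log (Real.sigmoid ξ) : ℂ) + Real.log (1 - Real.sigmoid ξ) =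
          -(2 * Real.log 2 + 2 * Real.log (Real.cosh (ξ / 2))) := by
        exact_mod_cast hlog2
      push_cast
      linear_combination (a / 2 : ℂ) * l2 + Complex.I * τ * l1
    rw [← e1]
    push_cast
    field_simp
  rw [hint] at hbeta
  have h2 : (((2 : ℝ) ^ a : ℝ) : ℂ) * (((2 : ℝ) ^ (-a) : ℝ) : ℂ) = 1 := by
    rw [← Complex.ofReal_mul, ← Real.rpow_add two_pos]; simp
  rw [Complex.ofReal_mul, hbeta]
  linear_combination (-(Real.Gamma a : ℂ) *
    ∫ ξ : ℝ, ((Real.cosh (ξ / 2) ^ (-a) : ℝ) : ℂ) * Complex.exp (Complex.I * τ * ξ)) * h2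

/-! ### Whittaker's equation in the variable √(2x); the parabolic cylinder function -/

theorem hasDerivAt_sqrt_two_mul {x : ℝ} (hx : 0 < x) :
    HasDerivAt (fun x : ℝ => √(2 * x)) (√(2 * x))⁻¹ x := by
  have h := ((hasDerivAt_id x).const_mul 2).sqrt (by simp [hx.ne'])
  refine h.congr_deriv ?_
  simp only [id]
  field_simp

theorem hasDerivAt_rpow_mul_exp_neg_half {β x : ℝ} (hx : 0 < x) :
    HasDerivAt (fun x : ℝ => ((x ^ β * Real.exp (-x / 2) : ℝ) : ℂ))
      (((x ^ β * Real.exp (-x / 2) : ℝ) : ℂ) * (β / x - 1 / 2)) x := by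
  have h1 := Real.hasDerivAt_rpow_const (p := β) (Or.inl hx.ne')
  have h2 : HasDerivAt (fun x : ℝ => Real.exp (-x / 2)) (Real.exp (-x / 2) * (-1 / 2)) x :=
    (((hasDerivAt_id x).neg).div_const 2).exp
  have h3 := (h1.mul h2).ofReal_comp
  refine h3.congr_deriv ?_
  have hx' : (x : ℂ) ≠ 0 := by exact_mod_cast hx.ne'
  have e : x ^ β = x ^ (β - 1) * x := by rw [← Real.rpow_add_one hx.ne']; congr 1; ring
  rw [e]
  push_cast
  field_simp
  ring

/-- A solution of a Weber-type equation in `r = √(2x)` gives the Whittaker function. -/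
theorem isWhittakerW_of_comp_sqrt {μ β a : ℝ} {ν C L : ℂ} {h₀ h₁ h₂ : ℝ → ℂ}
    (hd₀ : ∀ r : ℝ, 0 < r → HasDerivAt h₀ (-h₁ r) r)
    (hd₁ : ∀ r : ℝ, 0 < r → HasDerivAt h₁ (-h₂ r) r)
    (hode : ∀ r : ℝ, 0 < r →
      ((β : ℂ) ^ 2 - β + 1 / 4 - ν ^ 2 + (μ - β) * r ^ 2 / 2) * h₀ r
        + ((r : ℂ) ^ 3 / 4 + (1 / 4 - β) * r) * h₁ r + (r : ℂ) ^ 2 / 4 * h₂ r = 0)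
    (ha : β - a / 2 = μ)
    (hlim : Tendsto (fun r : ℝ => ((r ^ a : ℝ) : ℂ) * h₀ r) atTop (nhds L))
    (hC : C * (((2 : ℝ) ^ (-(a / 2)) : ℝ) : ℂ) * L = 1) :
    IsWhittakerW μ ν
      (fun x : ℝ => C * (((x ^ β * Real.exp (-x / 2) : ℝ) : ℂ) * h₀ (√(2 * x)))) := by
  set P : ℝ → ℂ := fun x => ((x ^ β * Real.exp (-x / 2) : ℝ) : ℂ) with hP
  have hcomp : ∀ {h h' : ℝ → ℂ}, (∀ r : ℝ, 0 < r → HasDerivAt h (-h' r) r) → ∀ x : ℝ, 0 < x →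
      HasDerivAt (fun x => h (√(2 * x))) (-h' (√(2 * x)) / (√(2 * x) : ℝ)) x := by
    intro h h' hd x hx
    have := HasDerivAt.scomp x (hd (√(2 * x)) (by positivity)) (hasDerivAt_sqrt_two_mul hx)
    refine this.congr_deriv ?_
    rw [Complex.real_smul, Complex.ofReal_inv, div_eq_inv_mul]
  have hd1 : ∀ x : ℝ, 0 < x → HasDerivAt (fun x => C * (P x * h₀ (√(2 * x))))
      (C * (P x * ((β / x - 1 / 2) * h₀ (√(2 * x)) - h₁ (√(2 * x)) / (√(2 * x) : ℝ)))) x := by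
    intro x hx
    refine (((hasDerivAt_rpow_mul_exp_neg_half (β := β) hx).mul (hcomp hd₀ x hx)).const_mul
      C).congr_deriv ?_
    simp only [hP]
    ring
  have hd2 : ∀ x : ℝ, 0 < x → HasDerivAt (fun x : ℝ =>
      C * (P x * ((β / x - 1 / 2) * h₀ (√(2 * x)) - h₁ (√(2 * x)) / (√(2 * x) : ℝ))))
      (C * (P x * ((β / x - 1 / 2) ^ 2 * h₀ (√(2 * x))
        - 2 * (β / x - 1 / 2) * (h₁ (√(2 * x)) / (√(2 * x) : ℝ))
        - β / x ^ 2 * h₀ (√(2 * x)) + h₁ (√(2 * x)) / (√(2 * x) : ℝ) ^ 3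
        + h₂ (√(2 * x)) / (√(2 * x) : ℝ) ^ 2))) x := by
    intro x hx
    have hx' : (x : ℂ) ≠ 0 := by exact_mod_cast hx.ne'
    have hr : 0 < √(2 * x) := by positivity
    have hr' : ((√(2 * x) : ℝ) : ℂ) ≠ 0 := by exact_mod_cast hr.ne'
    have hid : HasDerivAt (fun x : ℝ => (x : ℂ)) 1 x := Complex.ofRealCLM.hasDerivAt
    have hs : HasDerivAt (fun x : ℝ => ((√(2 * x) : ℝ) : ℂ)) (((√(2 * x))⁻¹ : ℝ) : ℂ) x :=
      (hasDerivAt_sqrt_two_mul hx).ofReal_comp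
    have hinner := ((((hasDerivAt_const x (β : ℂ)).div hid hx').sub_const (1 / 2 : ℂ)).mul
      (hcomp hd₀ x hx)).sub ((hcomp hd₁ x hx).div hs hr')
    refine (((hasDerivAt_rpow_mul_exp_neg_half (β := β) hx).mul hinner).const_mul
      C).congr_deriv ?_
    simp only [hP, Pi.sub_apply, Pi.mul_apply, Pi.div_apply]
    push_cast
    field_simp
    ring
  have hev : ∀ x : ℝ, 0 < x → deriv (fun x => C * (P x * h₀ (√(2 * x)))) =ᶠ[nhds x] fun x : ℝ =>
      C * (P x * ((β / x - 1 / 2) * h₀ (√(2 * x)) - h₁ (√(2 * x)) / (√(2 * x) : ℝ))) := by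
    intro x hx
    filter_upwards [Ioi_mem_nhds hx] with y hy
    exact (hd1 y hy).deriv
  refine ⟨fun x hx => (hd1 x hx).differentiableAt.differentiableWithinAt, fun x hx =>
    ((hev x hx).differentiableAt_iff.2 (hd2 x hx).differentiableAt).differentiableWithinAt,
    fun x hx => ?_, ?_⟩
  · rw [(hev x hx).deriv_eq, (hd2 x hx).deriv]
    have hx' : (x : ℂ) ≠ 0 := by exact_mod_cast hx.ne'
    have hr : 0 < √(2 * x) := by positivity
    have hr' : ((√(2 * x) : ℝ) : ℂ) ≠ 0 := by exact_mod_cast hr.ne'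
    -- `hode` is `x²` times Whittaker's equation with the factor `C x^β exp(-x/2)` removed, written
    -- in `r` through `x = r²/2`.
    have h := hode _ hr
    change _ + _ * (C * (P x * h₀ (√(2 * x)))) = 0
    have hxr : (x : ℂ) = ((√(2 * x) : ℝ) : ℂ) ^ 2 / 2 := by
      rw [← Complex.ofReal_pow, Real.sq_sqrt (by positivity)]
      push_cast
      ring
    generalize P x = p
    generalize ((√(2 * x) : ℝ) : ℂ) = r at *
    generalize h₀ (√(2 * x)) = y₀ at *
    generalize h₁ (√(2 * x)) = y₁ at *
    generalize h₂ (√(2 * x)) = y₂ at *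
    rw [hxr]
    field_simp
    linear_combination (C * p * 64) * h
  · have hA0 : ∀ᶠ x : ℝ in atTop, ((x ^ μ * Real.exp (-x / 2) : ℝ) : ℂ) ≠ 0 := by
      filter_upwards [eventually_gt_atTop 0] with x hx
      exact_mod_cast (by positivity : (0 : ℝ) < x ^ μ * Real.exp (-x / 2)).ne'
    rw [isEquivalent_iff_tendsto_one hA0]
    have hs : Tendsto (fun x : ℝ => √(2 * x)) atTop atTop :=
      Real.tendsto_sqrt_atTop.comp (tendsto_id.const_mul_atTop two_pos)
    -- As `r^a = 2^(a/2) x^(a/2)`, the product `x^β h₀(r)` behaves like `2^(-a/2) L x^(β - a/2)`: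
    -- `ha` matches the exponent and `hC` the constant.
    have h := (hlim.comp hs).const_mul (C * (((2 : ℝ) ^ (-(a / 2)) : ℝ) : ℂ))
    rw [hC] at h
    refine h.congr' ?_
    filter_upwards [eventually_gt_atTop 0] with x hx
    have e1 : (√(2 * x)) ^ a = 2 ^ (a / 2) * x ^ (a / 2) := by
      rw [Real.sqrt_eq_rpow, ← Real.rpow_mul (by positivity), Real.mul_rpow two_pos.le hx.le]
      congr 2 <;> ring
    have e2 : x ^ β = x ^ μ * x ^ (a / 2) := by
      rw [← Real.rpow_add hx]; congr 1; linarith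
    have e3 : (((2 : ℝ) ^ (-(a / 2)) : ℝ) : ℂ) * (((2 : ℝ) ^ (a / 2) : ℝ) : ℂ) = 1 := by
      rw [← Complex.ofReal_mul, ← Real.rpow_add two_pos]; simp
    have q1 : ((x ^ μ : ℝ) : ℂ) ≠ 0 := by exact_mod_cast (Real.rpow_pos_of_pos hx μ).ne'
    have q2 : ((Real.exp (-x / 2) : ℝ) : ℂ) ≠ 0 := by exact_mod_cast (Real.exp_pos _).ne'
    simp only [Function.comp_apply, Pi.div_apply, e1, e2, Complex.ofReal_mul]
    field_simp
    linear_combination (C * ((x ^ (a / 2) : ℝ) : ℂ) * h₀ (√(2 * x))) * e3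

/-- For `β = ν = 1/4` the constant coefficient vanishes and the Weber-type equation is `r²/4` times
the recurrence `weberIntegral_add_two`. -/
theorem whittakerW_one_fourth {a y : ℝ} (ha : 0 < a) (hy : 0 < y) :
    whittakerW (1 / 4 - a / 2) (1 / 4) y =
      ((2 ^ (a / 2) / Real.Gamma a * (y ^ (1 / 4 : ℝ) * Real.exp (-y / 2))
        * weberIntegral a (√(2 * y)) : ℝ) : ℂ) := by
  have hG := Real.Gamma_pos_of_pos ha
  have h := isWhittakerW_of_comp_sqrt (μ := 1 / 4 - a / 2) (β := 1 / 4) (a := a) (ν := 1 / 4)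
    (C := ((2 ^ (a / 2) / Real.Gamma a : ℝ) : ℂ)) (L := (Real.Gamma a : ℂ))
    (h₀ := fun r => (weberIntegral a r : ℂ)) (h₁ := fun r => (weberIntegral (a + 1) r : ℂ))
    (h₂ := fun r => (weberIntegral (a + 2) r : ℂ)) ?_ ?_ ?_ (by ring) ?_ ?_
  · rw [whittakerW_eq h hy]
    push_cast
    ring
  · intro r hr
    simpa using (hasDerivAt_weberIntegral ha hr).ofReal_comp
  · intro r hr
    have := (hasDerivAt_weberIntegral (a := a + 1) (by linarith) hr).ofReal_comp
    rw [show a + 1 + 1 = a + 2 by ring] at this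
    simpa using this
  · intro r hr
    rw [weberIntegral_add_two ha hr]
    push_cast
    ring
  · have := (Complex.continuous_ofReal.tendsto _).comp (tendsto_rpow_mul_weberIntegral ha)
    simpa [Function.comp_def] using this
  · rw [← Complex.ofReal_mul, ← Complex.ofReal_mul, ← Complex.ofReal_one]
    congr 1
    rw [Real.rpow_neg two_pos.le]
    field_simp

/-- The classical integral representation of `D_{-a}` for `a > 0`. -/
theorem parabolicCylinderD_neg {a z : ℝ} (ha : 0 < a) (hz : 0 < z) :
    parabolicCylinderD (-a) z =
      ((Real.exp (-z ^ 2 / 4) / Real.Gamma a * weberIntegral a z : ℝ) : ℂ) := by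
  rw [parabolicCylinderD, show -a / 2 + 1 / 4 = 1 / 4 - a / 2 by ring,
    whittakerW_one_fourth ha (by positivity), ← Complex.ofReal_mul,
    show 2 * (z ^ 2 / 2) = z ^ 2 by ring, Real.sqrt_sq hz.le]
  congr 1
  have e1 : (2 : ℝ) ^ (1 / 4 - a / 2) * 2 ^ (a / 2) = 2 ^ (1 / 4 : ℝ) := by
    rw [← Real.rpow_add two_pos]; congr 1; ring
  have e2 : (z ^ 2 / 2) ^ (1 / 4 : ℝ) = z ^ (1 / 2 : ℝ) * (2 ^ (1 / 4 : ℝ))⁻¹ := by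
    rw [Real.div_rpow (by positivity) two_pos.le, ← Real.rpow_natCast, ← Real.rpow_mul hz.le,
      div_eq_mul_inv]
    norm_num
  have e3 : z ^ (-(1 / 2) : ℝ) * z ^ (1 / 2 : ℝ) = 1 := by
    rw [← Real.rpow_add hz]; simp
  have e4 : (2 : ℝ) ^ (1 / 4 : ℝ) ≠ 0 := (Real.rpow_pos_of_pos two_pos _).ne'
  rw [e2, show -(z ^ 2 / 2) / 2 = -z ^ 2 / 4 by ring]
  calc _ = ((2 : ℝ) ^ (1 / 4 - a / 2) * 2 ^ (a / 2)) * (2 ^ (1 / 4 : ℝ))⁻¹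
        * (z ^ (-(1 / 2) : ℝ) * z ^ (1 / 2 : ℝ))
        * (Real.exp (-z ^ 2 / 4) / Real.Gamma a * weberIntegral a z) := by ring
    _ = _ := by rw [e1, e3, mul_inv_cancel₀ e4, one_mul, one_mul]

/-! ### The kernel and its Fourier transform as functions of r -/

/-- The kernel `cosh (ξ / 2) ^ k * weberIntegral (a + k) (r * cosh (ξ / 2))`, up to sign the `k`-th
derivative in `r` of `weberIntegral a (r * cosh (ξ / 2))`. -/
noncomputable def coshKernel (a : ℝ) (k : ℕ) (r ξ : ℝ) : ℝ :=
  Real.cosh (ξ / 2) ^ k * weberIntegral (a + k) (r * Real.cosh (ξ / 2))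

/-- The Fourier transform in `ξ` of `coshKernel a k r ξ`. -/
noncomputable def coshTransform (a τ : ℝ) (k : ℕ) (r : ℝ) : ℂ :=
  ∫ ξ : ℝ, (coshKernel a k r ξ : ℂ) * Complex.exp (Complex.I * τ * ξ)

theorem norm_exp_I_mul_mul (τ ξ : ℝ) : ‖Complex.exp (Complex.I * τ * ξ)‖ = 1 := by
  rw [show Complex.I * τ * ξ = ((τ * ξ : ℝ) : ℂ) * Complex.I by push_cast; ring]
  exact Complex.norm_exp_ofReal_mul_I _

theorem coshKernel_nonneg (a : ℝ) (k : ℕ) (r ξ : ℝ) : 0 ≤ coshKernel a k r ξ :=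
  mul_nonneg (pow_nonneg (Real.cosh_pos _).le _) (weberIntegral_nonneg _ _)

/-- Each `r`-derivative costs a factor `cosh(ξ/2)` but raises the decay of Weber's integral by one
power, so every `k` has the same majorant `cosh(ξ/2)^(-a)`, uniformly for `r ≥ r₀`. -/
theorem coshKernel_le {a : ℝ} (ha : 0 < a) (k : ℕ) {r₀ r : ℝ} (hr₀ : 0 < r₀) (hr : r₀ ≤ r)
    (ξ : ℝ) :
    coshKernel a k r ξ ≤ Real.Gamma (a + k) * r₀ ^ (-(a + k)) * Real.cosh (ξ / 2) ^ (-a) := by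
  have hc := Real.cosh_pos (ξ / 2)
  have hak : 0 < a + k := by positivity
  have hrpos := hr₀.trans_le hr
  have hG := Real.Gamma_pos_of_pos hak
  calc coshKernel a k r ξ
      ≤ Real.cosh (ξ / 2) ^ k * (Real.Gamma (a + k) * (r * Real.cosh (ξ / 2)) ^ (-(a + k))) := by
        unfold coshKernel
        gcongr
        exact weberIntegral_le hak (by positivity)
    _ = Real.Gamma (a + k) * r ^ (-(a + k)) * Real.cosh (ξ / 2) ^ (-a) := by
        have e : Real.cosh (ξ / 2) ^ (-a) =
            Real.cosh (ξ / 2) ^ k * Real.cosh (ξ / 2) ^ (-(a + k)) := by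
          rw [← Real.rpow_natCast, ← Real.rpow_add hc]; congr 1; ring
        rw [Real.mul_rpow hrpos.le hc.le, e]
        ring
    _ ≤ _ := by
        gcongr ?_ * ?_ * ?_
        exact Real.rpow_le_rpow_of_nonpos hr₀ hr (neg_nonpos.2 hak.le)

theorem continuous_coshKernel {a : ℝ} (ha : 0 < a) (k : ℕ) {r : ℝ} (hr : 0 < r) :
    Continuous (coshKernel a k r) := by
  have hak : 0 < a + k := by positivity
  have h : Continuous fun ξ : ℝ => weberIntegral (a + k) (r * Real.cosh (ξ / 2)) :=
    (continuousOn_weberIntegral hak).comp_continuous (by fun_prop)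
      fun ξ => mul_pos hr (Real.cosh_pos _)
  unfold coshKernel
  fun_prop

theorem integrable_coshKernel {a : ℝ} (ha : 0 < a) (k : ℕ) {r : ℝ} (hr : 0 < r) :
    Integrable (coshKernel a k r) := by
  refine Integrable.mono' ((integrable_rpow_neg_cosh ha).const_mul
    (Real.Gamma (a + k) * r ^ (-(a + k))))
    (continuous_coshKernel ha k hr).aestronglyMeasurable (Eventually.of_forall fun ξ => ?_)
  rw [Real.norm_of_nonneg (coshKernel_nonneg _ _ _ _)]
  exact coshKernel_le ha k hr le_rfl ξ

theorem MeasureTheory.Integrable.ofReal_mul_exp_I {g : ℝ → ℝ} (hg : Integrable g) (τ : ℝ) :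
    Integrable fun ξ : ℝ => (g ξ : ℂ) * Complex.exp (Complex.I * τ * ξ) :=
  hg.ofReal.mul_bdd (c := 1) (by fun_prop)
    (Eventually.of_forall fun ξ => (norm_exp_I_mul_mul τ ξ).le)

theorem hasDerivAt_coshKernel {a : ℝ} (ha : 0 < a) (k : ℕ) {r : ℝ} (hr : 0 < r) (ξ : ℝ) :
    HasDerivAt (fun r => coshKernel a k r ξ) (-coshKernel a (k + 1) r ξ) r := by
  have hak : 0 < a + k := by positivity
  have hc := Real.cosh_pos (ξ / 2)
  have h := ((hasDerivAt_weberIntegral hak (mul_pos hr hc)).comp r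
    ((hasDerivAt_id r).mul_const (Real.cosh (ξ / 2)))).const_mul (Real.cosh (ξ / 2) ^ k)
  refine h.congr_deriv ?_
  simp only [coshKernel]
  push_cast
  rw [add_assoc]
  ring

theorem hasDerivAt_coshTransform {a : ℝ} (ha : 0 < a) (τ : ℝ) (k : ℕ) {r : ℝ} (hr : 0 < r) :
    HasDerivAt (coshTransform a τ k) (-coshTransform a τ (k + 1) r) r := by
  have key := hasDerivAt_integral_of_dominated_loc_of_deriv_le
    (μ := volume) (x₀ := r) (s := Ioi (r / 2))
    (F := fun r ξ : ℝ => (coshKernel a k r ξ : ℂ) * Complex.exp (Complex.I * τ * ξ))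
    (F' := fun r ξ : ℝ => -((coshKernel a (k + 1) r ξ : ℂ) * Complex.exp (Complex.I * τ * ξ)))
    (bound := fun ξ => Real.Gamma (a + (k + 1 : ℕ)) * (r / 2) ^ (-(a + (k + 1 : ℕ)))
      * Real.cosh (ξ / 2) ^ (-a))
    (Ioi_mem_nhds (by linarith)) ?_
    ((integrable_coshKernel ha k hr).ofReal_mul_exp_I τ)
    ((integrable_coshKernel ha (k + 1) hr).ofReal_mul_exp_I τ).neg.aestronglyMeasurable
    ?_ ((integrable_rpow_neg_cosh ha).const_mul _) ?_
  · have h := key.2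
    rw [integral_neg] at h
    exact h
  · filter_upwards [Ioi_mem_nhds hr] with y hy
    exact ((integrable_coshKernel ha k hy).ofReal_mul_exp_I τ).aestronglyMeasurable
  · refine Eventually.of_forall fun ξ y (hy : r / 2 < y) => ?_
    rw [norm_neg, norm_mul, norm_exp_I_mul_mul, mul_one, Complex.norm_real,
      Real.norm_of_nonneg (coshKernel_nonneg _ _ _ _)]
    exact coshKernel_le ha (k + 1) (by positivity) hy.le ξ
  · refine Eventually.of_forall fun ξ y (hy : r / 2 < y) => ?_
    have hy0 : 0 < y := by linarith
    refine ((hasDerivAt_coshKernel ha k hy0 ξ).ofReal_comp.mul_const _).congr_deriv ?_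
    push_cast
    ring

theorem tendsto_rpow_mul_coshTransform {a : ℝ} (ha : 0 < a) (τ : ℝ) :
    Tendsto (fun r : ℝ => ((r ^ a : ℝ) : ℂ) * coshTransform a τ 0 r) atTop
      (nhds ((2 ^ a * ‖Complex.Gamma ((a / 2 : ℝ) + Complex.I * τ)‖ ^ 2 : ℝ) : ℂ)) := by
  have key : Tendsto (fun r : ℝ => ∫ ξ : ℝ, ((r ^ a * coshKernel a 0 r ξ : ℝ) : ℂ)
        * Complex.exp (Complex.I * τ * ξ)) atTop
      (nhds (∫ ξ : ℝ, ((Real.Gamma a * Real.cosh (ξ / 2) ^ (-a) : ℝ) : ℂ)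
        * Complex.exp (Complex.I * τ * ξ))) := by
    refine tendsto_integral_filter_of_dominated_convergence
      (fun ξ => Real.Gamma a * Real.cosh (ξ / 2) ^ (-a)) ?_ ?_
      ((integrable_rpow_neg_cosh ha).const_mul _) ?_
    · filter_upwards [eventually_gt_atTop 0] with r hr
      exact (((integrable_coshKernel ha 0 hr).const_mul _).ofReal_mul_exp_I τ).aestronglyMeasurable
    · filter_upwards [eventually_gt_atTop 0] with r hr
      refine Eventually.of_forall fun ξ => ?_
      have hra := Real.rpow_pos_of_pos hr a
      rw [norm_mul, norm_exp_I_mul_mul, mul_one, Complex.norm_real,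
        Real.norm_of_nonneg (mul_nonneg hra.le (coshKernel_nonneg _ _ _ _))]
      have h := mul_le_mul_of_nonneg_left (coshKernel_le ha 0 hr le_rfl ξ) hra.le
      refine h.trans_eq ?_
      rw [Nat.cast_zero, add_zero, Real.rpow_neg hr.le]
      field_simp
    · refine Eventually.of_forall fun ξ => Tendsto.mul_const _ ?_
      refine (Complex.continuous_ofReal.tendsto _).comp ?_
      have hc := Real.cosh_pos (ξ / 2)
      have h := ((tendsto_rpow_mul_weberIntegral ha).comp
        (tendsto_id.atTop_mul_const hc)).mul_const (Real.cosh (ξ / 2) ^ (-a))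
      refine h.congr' ?_
      filter_upwards [eventually_gt_atTop 0] with r hr
      have hca := (Real.rpow_pos_of_pos hc a).ne'
      simp only [coshKernel, Function.comp_apply, id, Nat.cast_zero, add_zero, pow_zero, one_mul]
      rw [Real.mul_rpow hr.le hc.le, Real.rpow_neg hc.le]
      field_simp
  have hL := integral_rpow_neg_cosh_mul_exp ha τ
  rw [← integral_const_mul] at hL
  rw [← hL]
  refine (key.congr fun r => ?_).trans_eq ?_
  · rw [coshTransform, ← integral_const_mul]
    congr 1
    ext ξ
    push_cast
    ring
  · congr 2
    ext ξ
    push_cast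
    ring

/-! ### The differential equation of the transform -/

/-- The second derivative in `ξ` of `weberIntegral a (r * cosh (ξ / 2))`. -/
noncomputable def coshKernelSnd (a r ξ : ℝ) : ℝ :=
  r ^ 2 / 4 * coshKernel a 2 r ξ + (r ^ 3 / 4 - r / 4) * coshKernel a 1 r ξ
    - a * r ^ 2 / 4 * coshKernel a 0 r ξ

theorem hasDerivAt_cosh_half (ξ : ℝ) :
    HasDerivAt (fun ξ : ℝ => Real.cosh (ξ / 2)) (Real.sinh (ξ / 2) / 2) ξ := by
  have := ((hasDerivAt_id ξ).div_const 2).cosh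
  exact this.congr_deriv (by simp only [id]; ring)

theorem hasDerivAt_sinh_half (ξ : ℝ) :
    HasDerivAt (fun ξ : ℝ => Real.sinh (ξ / 2)) (Real.cosh (ξ / 2) / 2) ξ := by
  have := ((hasDerivAt_id ξ).div_const 2).sinh
  exact this.congr_deriv (by simp only [id]; ring)

theorem hasDerivAt_weberIntegral_mul_cosh {a : ℝ} (ha : 0 < a) {r : ℝ} (hr : 0 < r) (ξ : ℝ) :
    HasDerivAt (fun ξ => weberIntegral a (r * Real.cosh (ξ / 2)))
      (-(r / 2 * Real.sinh (ξ / 2) * weberIntegral (a + 1) (r * Real.cosh (ξ / 2)))) ξ := by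
  have h := (hasDerivAt_weberIntegral ha (mul_pos hr (Real.cosh_pos (ξ / 2)))).comp ξ
    ((hasDerivAt_cosh_half ξ).const_mul r)
  exact h.congr_deriv (by ring)

/-- Replacing `sinh²` by `cosh² - 1` leaves a stray `U_{a+2}` without its `cosh²`, which the
recurrence rewrites through `U_a` and `cosh · U_{a+1}`. The result combines the kernels with
coefficients free of `ξ`. -/
theorem hasDerivAt_sinh_mul_weberIntegral {a : ℝ} (ha : 0 < a) {r : ℝ} (hr : 0 < r) (ξ : ℝ) :
    HasDerivAt
      (fun ξ => -(r / 2 * Real.sinh (ξ / 2) * weberIntegral (a + 1) (r * Real.cosh (ξ / 2))))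
      (coshKernelSnd a r ξ) ξ := by
  have hc := mul_pos hr (Real.cosh_pos (ξ / 2))
  have h := (((hasDerivAt_sinh_half ξ).const_mul (r / 2)).mul
    (hasDerivAt_weberIntegral_mul_cosh (a := a + 1) (by linarith) hr ξ)).neg
  refine h.congr_deriv ?_
  have hrec := weberIntegral_add_two ha hc
  simp only [coshKernelSnd, coshKernel, Nat.cast_zero, Nat.cast_one, Nat.cast_ofNat, add_zero,
    pow_zero, pow_one, one_mul, show a + 1 + 1 = a + 2 by ring]
  have hs := Real.sinh_sq (ξ / 2)
  linear_combination
    (r ^ 2 / 4 * weberIntegral (a + 2) (r * Real.cosh (ξ / 2))) * hs - r ^ 2 / 4 * hrec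

theorem integrable_coshKernelSnd {a : ℝ} (ha : 0 < a) {r : ℝ} (hr : 0 < r) :
    Integrable (coshKernelSnd a r) :=
  (((integrable_coshKernel ha 2 hr).const_mul _).add
    ((integrable_coshKernel ha 1 hr).const_mul _)).sub
    ((integrable_coshKernel ha 0 hr).const_mul _)

theorem integrable_sinh_mul_weberIntegral {a : ℝ} (ha : 0 < a) {r : ℝ} (hr : 0 < r) :
    Integrable
      fun ξ => -(r / 2 * Real.sinh (ξ / 2) * weberIntegral (a + 1) (r * Real.cosh (ξ / 2))) := by
  refine Integrable.mono' ((integrable_coshKernel ha 1 hr).const_mul (r / 2))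
    (Differentiable.continuous fun ξ =>
      (hasDerivAt_sinh_mul_weberIntegral ha hr ξ).differentiableAt).aestronglyMeasurable
    (Eventually.of_forall fun ξ => ?_)
  have hs : |Real.sinh (ξ / 2)| ≤ Real.cosh (ξ / 2) :=
    abs_le_of_sq_le_sq (by rw [Real.sinh_sq]; linarith) (Real.cosh_pos _).le
  have hw := weberIntegral_nonneg (a + 1) (r * Real.cosh (ξ / 2))
  rw [norm_neg, Real.norm_eq_abs, abs_mul, abs_mul, abs_of_pos (half_pos hr), abs_of_nonneg hw]
  simp only [coshKernel, Nat.cast_one, pow_one]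
  rw [mul_assoc]
  gcongr

theorem integral_mul_exp_of_hasDerivAt {g g' : ℝ → ℝ} (hg : ∀ ξ, HasDerivAt g (g' ξ) ξ)
    (hgi : Integrable g) (hgi' : Integrable g') (τ : ℝ) :
    ∫ ξ : ℝ, (g' ξ : ℂ) * Complex.exp (Complex.I * τ * ξ) =
      -(Complex.I * τ) * ∫ ξ : ℝ, (g ξ : ℂ) * Complex.exp (Complex.I * τ * ξ) := by
  have he : ∀ ξ : ℝ, HasDerivAt (fun ξ : ℝ => Complex.exp (Complex.I * τ * ξ))
      (Complex.I * τ * Complex.exp (Complex.I * τ * ξ)) ξ := by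
    intro ξ
    have h1 : HasDerivAt (fun ξ : ℝ => Complex.I * τ * (ξ : ℂ)) (Complex.I * τ * 1) ξ :=
      (Complex.ofRealCLM.hasDerivAt (x := ξ)).const_mul _
    exact h1.cexp.congr_deriv (by ring)
  have e1 : ∀ ξ : ℝ, (g ξ : ℂ) * (Complex.I * τ * Complex.exp (Complex.I * τ * ξ)) =
      Complex.I * τ * ((g ξ : ℂ) * Complex.exp (Complex.I * τ * ξ)) := fun ξ => by ring
  have key := integral_mul_deriv_eq_deriv_mul_of_integrable
    (u := fun ξ : ℝ => (g ξ : ℂ)) (u' := fun ξ : ℝ => (g' ξ : ℂ))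
    (v := fun ξ : ℝ => Complex.exp (Complex.I * τ * ξ))
    (v' := fun ξ : ℝ => Complex.I * τ * Complex.exp (Complex.I * τ * ξ))
    (fun ξ _ => (hg ξ).ofReal_comp) (fun ξ _ => he ξ) ?_ (hgi'.ofReal_mul_exp_I τ)
    (hgi.ofReal_mul_exp_I τ)
  · simp only [e1] at key
    rw [integral_const_mul] at key
    linear_combination key
  · exact ((hgi.ofReal_mul_exp_I τ).const_mul (Complex.I * τ)).congr
      (Eventually.of_forall fun ξ => (e1 ξ).symm)

theorem integral_coshKernelSnd_mul_exp {a : ℝ} (ha : 0 < a) (τ : ℝ) {r : ℝ} (hr : 0 < r) :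
    ∫ ξ : ℝ, (coshKernelSnd a r ξ : ℂ) * Complex.exp (Complex.I * τ * ξ) =
      -(τ : ℂ) ^ 2 * coshTransform a τ 0 r := by
  have e : ∀ ξ, weberIntegral a (r * Real.cosh (ξ / 2)) = coshKernel a 0 r ξ := fun ξ => by
    simp [coshKernel]
  have i0 : Integrable fun ξ => weberIntegral a (r * Real.cosh (ξ / 2)) := by
    simpa only [e] using integrable_coshKernel ha 0 hr
  have i1 := integrable_sinh_mul_weberIntegral ha hr
  rw [integral_mul_exp_of_hasDerivAt (hasDerivAt_sinh_mul_weberIntegral ha hr) i1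
      (integrable_coshKernelSnd ha hr),
    integral_mul_exp_of_hasDerivAt (hasDerivAt_weberIntegral_mul_cosh ha hr) i0 i1]
  simp only [e]
  rw [← coshTransform]
  linear_combination (τ : ℂ) ^ 2 * coshTransform a τ 0 r * Complex.I_sq

theorem coshTransform_ode {a : ℝ} (ha : 0 < a) (τ : ℝ) {r : ℝ} (hr : 0 < r) :
    (r : ℂ) ^ 2 / 4 * coshTransform a τ 2 r + ((r : ℂ) ^ 3 / 4 - r / 4) * coshTransform a τ 1 r
      - a * (r : ℂ) ^ 2 / 4 * coshTransform a τ 0 r = -(τ : ℂ) ^ 2 * coshTransform a τ 0 r := by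
  rw [← integral_coshKernelSnd_mul_exp ha τ hr]
  simp only [coshTransform, ← integral_const_mul]
  have i := fun k (c : ℂ) => ((integrable_coshKernel ha k hr).ofReal_mul_exp_I τ).const_mul c
  rw [← integral_add (i 2 _) (i 1 _)]
  refine (integral_sub ((i 2 _).add (i 1 _)) (i 0 _)).symm.trans ?_
  congr 1
  ext ξ
  simp only [coshKernelSnd, Pi.add_apply]
  push_cast
  ring

/-- Both the transform and `τ²` times it are Fourier integrals of integrable functions, the kernel
and (up to sign) its second derivative; add the two `L¹` bounds. -/
theorem norm_coshTransform_le {a : ℝ} (ha : 0 < a) {r : ℝ} (hr : 0 < r) :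
    ∃ M : ℝ, ∀ τ, ‖coshTransform a τ 0 r‖ ≤ M * (1 + τ ^ 2)⁻¹ := by
  refine ⟨(∫ ξ, ‖coshKernel a 0 r ξ‖) + ∫ ξ, ‖coshKernelSnd a r ξ‖, fun τ => ?_⟩
  have h : ∀ g : ℝ → ℝ, ‖∫ ξ : ℝ, (g ξ : ℂ) * Complex.exp (Complex.I * τ * ξ)‖ ≤ ∫ ξ, ‖g ξ‖ := by
    intro g
    refine (norm_integral_le_integral_norm _).trans_eq ?_
    simp only [norm_mul, norm_exp_I_mul_mul, mul_one, Complex.norm_real]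
  have h0 := h (coshKernel a 0 r)
  have h2 := h (coshKernelSnd a r)
  rw [integral_coshKernelSnd_mul_exp ha τ hr, norm_mul, norm_neg, norm_pow, Complex.norm_real,
    Real.norm_eq_abs, sq_abs] at h2
  rw [← coshTransform] at h0
  rw [← div_eq_mul_inv, le_div_iff₀ (by positivity)]
  linarith

/-! ### Identification of both sides with the kernel and its transform -/

/-- The integral representation of `|Γ(1/2 - μ + iτ)|² W_{μ,iτ}`, with `a = 1 - 2μ`. -/
theorem gammaWhittaker_eq {a x : ℝ} (ha : 0 < a) (hx : 0 < x) (τ : ℝ) :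
    gammaWhittaker ((1 - a) / 2) x τ =
      ((2 ^ (-(a / 2)) * (√x * Real.exp (-x / 2)) : ℝ) : ℂ) * coshTransform a τ 0 (√(2 * x)) := by
  set G : ℝ := ‖Complex.Gamma ((a / 2 : ℝ) + Complex.I * τ)‖ ^ 2 with hG
  have hGpos : 0 < G := by
    refine pow_pos (norm_pos_iff.2 (Complex.Gamma_ne_zero_of_re_pos ?_)) 2
    simpa using ha
  have h2 : (0 : ℝ) < 2 ^ (a / 2) := Real.rpow_pos_of_pos two_pos _
  -- With `β = 1/2` and `ν = iτ` the constant coefficient reduces to `-ν² = τ²`, and the Weber-type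
  -- equation becomes `coshTransform_ode`.
  have h := isWhittakerW_of_comp_sqrt (μ := (1 - a) / 2) (β := 1 / 2) (a := a)
    (ν := Complex.I * τ) (C := ((2 ^ (-(a / 2)) / G : ℝ) : ℂ))
    (h₀ := coshTransform a τ 0) (h₁ := coshTransform a τ 1) (h₂ := coshTransform a τ 2)
    (fun r hr => hasDerivAt_coshTransform ha τ 0 hr)
    (fun r hr => hasDerivAt_coshTransform ha τ 1 hr) ?_ (by ring)
    (tendsto_rpow_mul_coshTransform ha τ) ?_
  · have e : (1 / 2 - (((1 - a) / 2 : ℝ) : ℂ) + Complex.I * τ) =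
        (a / 2 : ℝ) + Complex.I * τ := by push_cast; ring
    rw [gammaWhittaker, whittakerW_eq h hx, e, ← hG, ← Real.sqrt_eq_rpow, ← mul_assoc, ← mul_assoc,
      ← Complex.ofReal_mul, ← Complex.ofReal_mul]
    congr 2
    field_simp
  · intro r hr
    have := coshTransform_ode ha τ hr
    push_cast
    linear_combination this - (τ : ℂ) ^ 2 * coshTransform a τ 0 r * Complex.I_sq
  · rw [← hG, ← Complex.ofReal_mul, ← Complex.ofReal_mul, ← Complex.ofReal_one]
    congr 1
    have e : (2 : ℝ) ^ a = 2 ^ (a / 2) * 2 ^ (a / 2) := by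
      rw [← Real.rpow_add two_pos]; congr 1; ring
    rw [Real.rpow_neg two_pos.le, e]
    field_simp

/-- With `z = √(2x) cosh(ξ/2)`, the exponents `x sinh²(ξ/2)/2` and `-z²/4` add up to `-x/2`, free of
`ξ`. -/
theorem expCylinder_eq {a x : ℝ} (ha : 0 < a) (hx : 0 < x) (ξ : ℝ) :
    expCylinder ((1 - a) / 2) x ξ =
      ((Real.exp (-x / 2) / Real.Gamma a * coshKernel a 0 (√(2 * x)) ξ : ℝ) : ℂ) := by
  have hc := Real.cosh_pos (ξ / 2)
  rw [expCylinder, show 2 * ((1 - a) / 2) - 1 = -a by ring,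
    parabolicCylinderD_neg ha (by positivity), ← Complex.ofReal_mul]
  congr 1
  have e : Real.exp (x * Real.sinh (ξ / 2) ^ 2 / 2) *
      Real.exp (-(√(2 * x) * Real.cosh (ξ / 2)) ^ 2 / 4) = Real.exp (-x / 2) := by
    rw [← Real.exp_add, mul_pow, Real.sq_sqrt (by positivity), Real.sinh_sq]
    congr 1
    ring
  simp only [coshKernel, pow_zero, one_mul, Nat.cast_zero, add_zero]
  rw [← e]
  ring

/-! ### Fourier inversion and Poisson summation for the kernel exp(iτξ) -/

theorem nonneg_of_norm_le_mul_inv {h : ℝ → ℂ} {M : ℝ} (hM : ∀ x, ‖h x‖ ≤ M * (1 + x ^ 2)⁻¹) :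
    0 ≤ M := by
  simpa using (norm_nonneg _).trans (hM 0)

theorem norm_comp_mul_le {h : ℝ → ℂ} {M : ℝ} (hM : ∀ x, ‖h x‖ ≤ M * (1 + x ^ 2)⁻¹) {c x : ℝ}
    (hc : c ≠ 0) (hx : x ≠ 0) : ‖h (c * x)‖ ≤ M / c ^ 2 * (1 / x ^ 2) := by
  refine (hM _).trans ?_
  have := nonneg_of_norm_le_mul_inv hM
  have hcx : 0 < (c * x) ^ 2 := by positivity
  calc M * (1 + (c * x) ^ 2)⁻¹ ≤ M * ((c * x) ^ 2)⁻¹ := by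
        gcongr
        linarith
    _ = _ := by field_simp

theorem isBigO_comp_mul_of_norm_le {h : ℝ → ℂ} {M : ℝ} (hM : ∀ x, ‖h x‖ ≤ M * (1 + x ^ 2)⁻¹)
    {c : ℝ} (hc : c ≠ 0) :
    (fun x => h (c * x)) =O[cocompact ℝ] fun x : ℝ => |x| ^ (-2 : ℝ) := by
  refine IsBigO.of_bound (M / c ^ 2) ?_
  filter_upwards [(isCompact_singleton (x := (0 : ℝ))).compl_mem_cocompact] with x hx
  refine (norm_comp_mul_le hM hc hx).trans_eq ?_
  rw [Real.norm_of_nonneg (by positivity), Real.rpow_neg (abs_nonneg x), Real.rpow_two, sq_abs,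
    one_div]

theorem summable_comp_mul_of_norm_le {h : ℝ → ℂ} {M : ℝ} (hM : ∀ x, ‖h x‖ ≤ M * (1 + x ^ 2)⁻¹)
    {c : ℝ} (hc : c ≠ 0) : Summable fun n : ℕ => h (c * (n + 1)) := by
  have hs : Summable fun n : ℕ => M / c ^ 2 * (1 / ((n + 1 : ℕ) : ℝ) ^ 2) :=
    ((summable_nat_add_iff 1).2 (Real.summable_one_div_nat_pow.2 one_lt_two)).mul_left _
  refine Summable.of_norm_bounded hs fun n => ?_
  rw [Nat.cast_add_one]
  exact norm_comp_mul_le hM hc (by positivity)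

theorem tsum_int_comp_mul_of_even {h : ℝ → ℂ} {M : ℝ} (hM : ∀ x, ‖h x‖ ≤ M * (1 + x ^ 2)⁻¹)
    (heven : ∀ x, h (-x) = h x) {c : ℝ} (hc : c ≠ 0) :
    ∑' n : ℤ, h (c * n) = h 0 + 2 * ∑' n : ℕ, h (c * (n + 1)) := by
  have hs := summable_comp_mul_of_norm_le hM hc
  have e1 : ∀ n : ℕ, h (c * (((n : ℤ) + 1 : ℤ) : ℝ)) = h (c * (n + 1)) := fun n => by push_cast; rfl
  have e2 : ∀ n : ℕ, h (c * ((-((n : ℤ) + 1) : ℤ) : ℝ)) = h (c * (n + 1)) := fun n => by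
    rw [← heven]; push_cast; congr 1; ring
  rw [tsum_of_add_one_of_neg_add_one (f := fun n : ℤ => h (c * n)) (by simpa only [e1] using hs)
    (by simpa only [e2] using hs)]
  simp only [e1, e2, Int.cast_zero, mul_zero]
  ring

open scoped FourierTransform in
theorem fourier_eq_integral_mul_exp_I (f : ℝ → ℂ) (w : ℝ) :
    𝓕 f w = ∫ ξ : ℝ, f ξ * Complex.exp (Complex.I * ((-(2 * Real.pi) * w : ℝ) : ℂ) * ξ) := by
  rw [Real.fourier_real_eq_integral_exp_smul]
  congr 1
  ext ξ
  rw [smul_eq_mul, mul_comm]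
  congr 2
  push_cast
  ring

open scoped FourierTransform in
/-- Fourier inversion for the transform with kernel `exp (i τ ξ)`. -/
theorem integral_mul_exp_neg_of_transform {f F : ℝ → ℂ}
    (hF : ∀ τ : ℝ, F τ = ∫ ξ : ℝ, f ξ * Complex.exp (Complex.I * τ * ξ)) (hc : Continuous f)
    (hf : Integrable f) (hFi : Integrable F) (ξ : ℝ) :
    ∫ τ : ℝ, F τ * Complex.exp (-(Complex.I * τ * ξ)) = 2 * Real.pi * f ξ := by
  have hpi := Real.pi_pos
  have e : 𝓕 f = fun w => F (-(2 * Real.pi) * w) := by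
    ext w
    rw [fourier_eq_integral_mul_exp_I, hF]
  have hi : Integrable (𝓕 f) := by
    rw [e]
    exact hFi.comp_mul_left' (by simp [hpi.ne'])
  have key := congrFun (hc.fourierInv_fourier_eq hf hi) ξ
  rw [Real.fourierInv_eq', e] at key
  -- The change of variable `τ = -2πw` passes from Mathlib's kernel `exp(-2πiwξ)` to `exp(iτξ)`; its
  -- Jacobian is the factor `2π`.
  have h := Measure.integral_comp_mul_left
    (fun τ : ℝ => F τ * Complex.exp (-(Complex.I * τ * ξ))) (-(2 * Real.pi))
  have e2 : ∫ w : ℝ, Complex.exp ((2 * Real.pi * inner ℝ w ξ : ℝ) * Complex.I)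
      • F (-(2 * Real.pi) * w) = ∫ w : ℝ, F (-(2 * Real.pi) * w)
        * Complex.exp (-(Complex.I * ((-(2 * Real.pi) * w : ℝ) : ℂ) * ξ)) := by
    congr 1
    ext w
    rw [smul_eq_mul, mul_comm]
    congr 2
    have hin : inner ℝ w ξ = ξ * w := by simp
    rw [hin]
    push_cast
    ring
  rw [e2, h, inv_neg, abs_neg, abs_of_pos (by positivity), Complex.real_smul] at key
  have h2pi : ((2 * Real.pi : ℝ) : ℂ) ≠ 0 := Complex.ofReal_ne_zero.2 (by positivity)
  rw [← key, Complex.ofReal_inv, show (2 * Real.pi : ℂ) = ((2 * Real.pi : ℝ) : ℂ) by push_cast; rfl,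
    mul_inv_cancel_left₀ h2pi]

open scoped FourierTransform in
/-- Poisson summation for an even function and the transform with kernel `exp (i τ ξ)`. -/
theorem poisson_summation_of_even {f F : ℝ → ℂ} {M M' α : ℝ}
    (hF : ∀ τ : ℝ, F τ = ∫ ξ : ℝ, f ξ * Complex.exp (Complex.I * τ * ξ)) (hc : Continuous f)
    (hf : ∀ ξ, ‖f ξ‖ ≤ M * (1 + ξ ^ 2)⁻¹) (hFb : ∀ τ, ‖F τ‖ ≤ M' * (1 + τ ^ 2)⁻¹)
    (heven : ∀ ξ, f (-ξ) = f ξ) (hα : 0 < α) :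
    F 0 + 2 * ∑' n : ℕ, F (α * (n + 1)) =
      2 * Real.pi / α * (f 0 + 2 * ∑' n : ℕ, f (2 * Real.pi / α * (n + 1))) := by
  have hpi := Real.pi_pos
  have hβ : 0 < 2 * Real.pi / α := by positivity
  have hFeven : ∀ τ, F (-τ) = F τ := by
    intro τ
    rw [hF, hF, ← integral_neg_eq_self]
    congr 1
    ext ξ
    rw [heven]
    push_cast
    congr 2
    ring
  -- After this dilation, summation over `ℤ` samples `f` on `(2π/α)ℤ` and `F` on `αℤ`. The sign in
  -- Mathlib's kernel is absorbed by the evenness of `F`.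
  have e : 𝓕 (fun ξ => f (2 * Real.pi / α * ξ)) =
      fun w => ((α / (2 * Real.pi) : ℝ) : ℂ) * F (α * w) := by
    ext w
    rw [← hFeven, fourier_eq_integral_mul_exp_I, hF]
    have h := Measure.integral_comp_mul_left
      (fun ξ : ℝ => f ξ * Complex.exp (Complex.I * ((-(α * w) : ℝ) : ℂ) * ξ)) (2 * Real.pi / α)
    rw [abs_of_pos (by positivity), Complex.real_smul, inv_div] at h
    rw [← h]
    congr 1
    ext ξ
    have : (α : ℂ) ≠ 0 := by exact_mod_cast hα.ne'
    congr 2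
    push_cast
    field_simp
  have hO : 𝓕 (fun ξ => f (2 * Real.pi / α * ξ)) =O[cocompact ℝ] fun x : ℝ => |x| ^ (-2 : ℝ) := by
    rw [e]
    exact (isBigO_comp_mul_of_norm_le hFb hα.ne').const_mul_left _
  have key := Real.tsum_eq_tsum_fourier_of_rpow_decay (f := fun ξ => f (2 * Real.pi / α * ξ))
    (by fun_prop) one_lt_two (isBigO_comp_mul_of_norm_le hf hβ.ne') hO 0
  simp only [zero_add, e] at key
  rw [tsum_int_comp_mul_of_even hf heven hβ.ne'] at key
  simp only [QuotientAddGroup.mk_zero, fourier_eval_zero, mul_one] at key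
  rw [tsum_mul_left, tsum_int_comp_mul_of_even hFb hFeven hα.ne'] at key
  rw [key]
  push_cast
  have h1 : (Real.pi : ℂ) ≠ 0 := by exact_mod_cast hpi.ne'
  have h2 : (α : ℂ) ≠ 0 := by exact_mod_cast hα.ne'
  field_simp

/-! ### The three formulas -/

theorem corollary9 (x α μ : ℝ) (hx : 0 < x) (hα : 0 < α) (hμ : μ < 1 / 2) :
    -- the summation formula, both series being (absolutely) convergent
    (Summable (fun n : ℕ => gammaWhittaker μ x (α * ((n : ℝ) + 1))) ∧
      Summable (fun n : ℕ =>
        ((Real.exp (x * Real.sinh (Real.pi * ((n : ℝ) + 1) / α) ^ 2 / 2) : ℝ) : ℂ)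
          * parabolicCylinderD (2 * μ - 1)
              (√(2 * x) * Real.cosh (Real.pi * ((n : ℝ) + 1) / α))) ∧
      ((Real.Gamma (1 / 2 - μ) ^ 2 : ℝ) : ℂ) * whittakerW μ 0 x
          + 2 * ∑' n : ℕ, gammaWhittaker μ x (α * ((n : ℝ) + 1))
        = ((Real.pi * (2 : ℝ) ^ (μ + 1 / 2) * √x / α * Real.Gamma (1 - 2 * μ) : ℝ) : ℂ)
          * (parabolicCylinderD (2 * μ - 1) √(2 * x)
            + 2 * ∑' n : ℕ,
                ((Real.exp (x * Real.sinh (Real.pi * ((n : ℝ) + 1) / α) ^ 2 / 2) : ℝ) : ℂ)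
                  * parabolicCylinderD (2 * μ - 1)
                      (√(2 * x) * Real.cosh (Real.pi * ((n : ℝ) + 1) / α)))) ∧
    -- the Fourier transform
    (∀ ξ : ℝ,
      Integrable (fun τ : ℝ =>
        gammaWhittaker μ x τ * Complex.exp (-(Complex.I * (τ : ℂ) * (ξ : ℂ)))) ∧
      ∫ τ : ℝ, gammaWhittaker μ x τ * Complex.exp (-(Complex.I * (τ : ℂ) * (ξ : ℂ)))
        = ((Real.pi * (2 : ℝ) ^ (μ + 1 / 2) * √x * Real.Gamma (1 - 2 * μ) : ℝ) : ℂ)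
          * expCylinder μ x ξ) ∧
    -- the inverse transform
    (∀ τ : ℝ,
      Integrable (fun ξ : ℝ =>
        expCylinder μ x ξ * Complex.exp (Complex.I * (τ : ℂ) * (ξ : ℂ))) ∧
      gammaWhittaker μ x τ
        = (((2 : ℝ) ^ (μ - 1 / 2) * √x * Real.Gamma (1 - 2 * μ) : ℝ) : ℂ)
          * ∫ ξ : ℝ, expCylinder μ x ξ * Complex.exp (Complex.I * (τ : ℂ) * (ξ : ℂ))) := by
  obtain ⟨a, ha, rfl⟩ : ∃ a : ℝ, 0 < a ∧ μ = (1 - a) / 2 :=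
    ⟨1 - 2 * μ, by linarith, by ring⟩
  have hr : 0 < √(2 * x) := by positivity
  have hG := Real.Gamma_pos_of_pos ha
  have hpi := Real.pi_pos
  set μ := (1 - a) / 2 with hμa
  have hμ1 : 1 - 2 * μ = a := by rw [hμa]; ring
  rw [hμ1]
  have hE : expCylinder μ x = fun ξ =>
      ((Real.exp (-x / 2) / Real.Gamma a * coshKernel a 0 (√(2 * x)) ξ : ℝ) : ℂ) :=
    funext (expCylinder_eq ha hx)
  have hW : gammaWhittaker μ x = fun τ : ℝ =>
      ((2 ^ (-(a / 2)) * (√x * Real.exp (-x / 2)) : ℝ) : ℂ) * coshTransform a τ 0 (√(2 * x)) :=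
    funext (gammaWhittaker_eq ha hx)
  have hEi : Integrable fun ξ : ℝ =>
      Real.exp (-x / 2) / Real.Gamma a * coshKernel a 0 (√(2 * x)) ξ :=
    (integrable_coshKernel ha 0 hr).const_mul _
  have hinv : ∀ τ : ℝ, Integrable (fun ξ : ℝ =>
        expCylinder μ x ξ * Complex.exp (Complex.I * (τ : ℂ) * (ξ : ℂ))) ∧
      gammaWhittaker μ x τ
        = (((2 : ℝ) ^ (μ - 1 / 2) * √x * Real.Gamma a : ℝ) : ℂ)
          * ∫ ξ : ℝ, expCylinder μ x ξ * Complex.exp (Complex.I * (τ : ℂ) * (ξ : ℂ)) := by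
    intro τ
    rw [hE]
    refine ⟨hEi.ofReal_mul_exp_I τ, ?_⟩
    rw [hW]
    simp only [coshTransform]
    rw [← integral_const_mul, ← integral_const_mul, show μ - 1 / 2 = -(a / 2) by rw [hμa]; ring]
    congr 1
    ext ξ
    have : (Real.Gamma a : ℂ) ≠ 0 := by exact_mod_cast hG.ne'
    push_cast
    field_simp
  -- the constant of the inverse transform
  set K : ℂ := (((2 : ℝ) ^ (μ - 1 / 2) * √x * Real.Gamma a : ℝ) : ℂ) with hK
  have hK0 : K ≠ 0 := by
    have : (0 : ℝ) < (2 : ℝ) ^ (μ - 1 / 2) * √x * Real.Gamma a := by positivity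
    exact Complex.ofReal_ne_zero.2 this.ne'
  -- Inversion multiplies the constant of (iii) by `2π`, which explains the constant in (ii).
  have h2K : 2 * Real.pi * K =
      ((Real.pi * (2 : ℝ) ^ (μ + 1 / 2) * √x * Real.Gamma a : ℝ) : ℂ) := by
    rw [hK, show μ + 1 / 2 = (μ - 1 / 2) + 1 by ring, Real.rpow_add_one two_ne_zero]
    push_cast
    ring
  have hEc : Continuous (expCylinder μ x) := by
    rw [hE]
    exact Complex.continuous_ofReal.comp ((continuous_coshKernel ha 0 hr).const_mul _)
  have hEI : Integrable (expCylinder μ x) := by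
    rw [hE]
    exact hEi.ofReal
  obtain ⟨M, hM⟩ : ∃ M : ℝ, ∀ ξ, ‖expCylinder μ x ξ‖ ≤ M * (1 + ξ ^ 2)⁻¹ := by
    refine ⟨Real.exp (-x / 2) / Real.Gamma a * (Real.Gamma (a + (0 : ℕ)) * √(2 * x) ^ (-(a + (0 : ℕ)))
      * (2 ^ a * (1 + 8 / a ^ 2))), fun ξ => ?_⟩
    have hk := coshKernel_nonneg a 0 (√(2 * x)) ξ
    have hG' : 0 < Real.Gamma (a + (0 : ℕ)) := by simpa using hG
    rw [hE, Complex.norm_real, Real.norm_of_nonneg (by positivity), mul_assoc, mul_assoc]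
    gcongr
    refine (coshKernel_le ha 0 hr le_rfl ξ).trans ?_
    gcongr
    exact rpow_neg_cosh_le ha ξ
  obtain ⟨M', hM'⟩ : ∃ M' : ℝ, ∀ τ, ‖gammaWhittaker μ x τ‖ ≤ M' * (1 + τ ^ 2)⁻¹ := by
    obtain ⟨M', hM'⟩ := norm_coshTransform_le ha hr
    refine ⟨‖((2 ^ (-(a / 2)) * (√x * Real.exp (-x / 2)) : ℝ) : ℂ)‖ * M', fun τ => ?_⟩
    rw [hW]
    simp only [norm_mul, mul_assoc]
    have := hM' τ
    gcongr
  set F : ℝ → ℂ := fun τ => ∫ ξ : ℝ, expCylinder μ x ξ * Complex.exp (Complex.I * τ * ξ) with hF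
  have hWF : ∀ τ, gammaWhittaker μ x τ = K * F τ := fun τ => (hinv τ).2
  have hFb : ∀ τ, ‖F τ‖ ≤ ‖K‖⁻¹ * M' * (1 + τ ^ 2)⁻¹ := by
    intro τ
    have := hM' τ
    rw [hWF, norm_mul] at this
    rwa [mul_assoc, ← div_eq_inv_mul, le_div_iff₀' (norm_pos_iff.2 hK0)]
  -- Continuity only supplies measurability of `F`; integrability comes from the bound `hFb`.
  have hFc : Continuous F := by
    refine continuous_of_dominated (bound := fun ξ => ‖expCylinder μ x ξ‖) (fun τ =>
      (hinv τ).1.aestronglyMeasurable) (fun τ => Eventually.of_forall fun ξ => ?_) hEI.norm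
      (Eventually.of_forall fun ξ => by fun_prop)
    rw [norm_mul, norm_exp_I_mul_mul, mul_one]
  have hFi : Integrable F :=
    Integrable.mono' (integrable_inv_one_add_sq.const_mul (‖K‖⁻¹ * M')) hFc.aestronglyMeasurable
      (Eventually.of_forall hFb)
  have heven : ∀ ξ, expCylinder μ x (-ξ) = expCylinder μ x ξ := by
    intro ξ
    simp only [expCylinder, neg_div, Real.sinh_neg, Real.cosh_neg, neg_sq]
  -- The sampling points are `ξ = 2π(n + 1)/α`, so `ξ/2` is the argument in the series; the shift to
  -- `n + 1` makes it start at 1.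
  have hD : ∀ n : ℕ,
      ((Real.exp (x * Real.sinh (Real.pi * ((n : ℝ) + 1) / α) ^ 2 / 2) : ℝ) : ℂ)
        * parabolicCylinderD (2 * μ - 1) (√(2 * x) * Real.cosh (Real.pi * ((n : ℝ) + 1) / α)) =
      expCylinder μ x (2 * Real.pi / α * (n + 1)) := by
    intro n
    rw [expCylinder, show 2 * Real.pi / α * ((n : ℝ) + 1) / 2 = Real.pi * ((n : ℝ) + 1) / α by ring]
  refine ⟨⟨summable_comp_mul_of_norm_le hM' hα.ne', ?_, ?_⟩, fun ξ => ⟨?_, ?_⟩, hinv⟩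
  · simp only [hD]
    exact summable_comp_mul_of_norm_le hM (by positivity)
  · have hP := poisson_summation_of_even (fun τ => rfl) hEc hM hFb heven hα
    have h0 : ((Real.Gamma (1 / 2 - μ) ^ 2 : ℝ) : ℂ) * whittakerW μ 0 x = K * F 0 := by
      rw [← hWF, gammaWhittaker, Complex.ofReal_zero, mul_zero, add_zero,
        show (1 / 2 - (μ : ℂ)) = ((1 / 2 - μ : ℝ) : ℂ) by push_cast; ring, Complex.Gamma_ofReal,
        Complex.norm_real, Real.norm_eq_abs, sq_abs]
    have h1 : parabolicCylinderD (2 * μ - 1) √(2 * x) = expCylinder μ x 0 := by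
      simp [expCylinder]
    have h2 : ((Real.pi * (2 : ℝ) ^ (μ + 1 / 2) * √x / α * Real.Gamma a : ℝ) : ℂ) =
        K * (2 * Real.pi / α) := by
      rw [show K * (2 * Real.pi / α) = (2 * Real.pi * K) / (α : ℂ) by ring, h2K]
      push_cast
      ring
    simp only [hD, hWF]
    rw [h0, h1, h2, tsum_mul_left, mul_assoc K, ← hP]
    ring
  · have hbdd : Integrable (fun τ : ℝ => F τ * Complex.exp (-(Complex.I * τ * ξ))) := by
      refine hFi.mul_bdd (c := 1) (by fun_prop) (Eventually.of_forall fun τ => ?_)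
      have := norm_exp_I_mul_mul τ (-ξ)
      rw [Complex.ofReal_neg, mul_neg] at this
      exact this.le
    simpa only [hWF, mul_assoc] using hbdd.const_mul K
  · simp only [hWF, mul_assoc K]
    rw [integral_const_mul, integral_mul_exp_neg_of_transform (fun τ => rfl) hEc hEI hFi ξ, ← h2K]
    ring
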